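/- For distributions $p,q$ on $[n]=\{1,\dots,n\}$ let $\mathcal U$ be the uniform distribution on $[n]$ and let $\Pi_q=\{(1-\alpha)q+\alpha\,\mathcal U : \alpha\in[0,1]\}$. A closeness tester in the presence of uniform noise, with proximity parameter $\epsilon$, is a randomized algorithm (which may depend on $n$ and $\epsilon$) that can, adaptively, request independent samples from each of the two unknown distributions $p$ and $q$, and that, for all distributions $p,q$ on $[n]$, - accepts with probability at least $2/3$ if $p\in\Pi_q$, and - rejects with probability at least $2/3$ if $\|p-r\|_1\ge\epsilon$ for every $r\in\Pi_q$. There is an absolute constant $c>0$ such that for every $n\ge 2$, every $0<\epsilon\le 1$ and every such tester that draws at most $s$ samples in total (from $p$ and $q$ together) in every execution, $$ s\;\ge\; c\cdot\max\left(\frac{n^{2/3}}{\epsilon^{4/3}},\;\frac{\sqrt n}{\epsilon^{2}}\right). $$ -/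

import Mathlib

namespace MixtureTesting

/-- The `ℓ₁`-distance between two distributions on `[n]`. -/
noncomputable def l1Dist {n : ℕ} (p q : PMF (Fin n)) : ℝ :=
  ∑ i, |(p i).toReal - (q i).toReal|

/-- The set of all mixtures `(1 - α) q₁ + α q₂` with `α ∈ [0, 1]`. -/
def mixtures {n : ℕ} (q₁ q₂ : PMF (Fin n)) : Set (PMF (Fin n)) :=
  {r | ∃ α ∈ Set.Icc (0 : ℝ) 1,
    ∀ i, (r i).toReal = (1 - α) * (q₁ i).toReal + α * (q₂ i).toReal}

/-- `p` is `ε`-far from the property `P`: its `ℓ₁`-distance to every member is at least `ε`. -/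
def IsFar {n : ℕ} (ε : ℝ) (p : PMF (Fin n)) (P : Set (PMF (Fin n))) : Prop :=
  ∀ r ∈ P, ε ≤ l1Dist p r

/-- A randomized algorithm with oracle access to samples from two unknown distributions `p`, `q`
on `[n]`. At each step it stops and outputs `true` (accept) or `false` (reject), uses internal
randomness, or requests a fresh sample from `p` or from `q`; the continuation may depend on
everything seen so far. -/
inductive Algorithm (n : ℕ) : Type
  | output (b : Bool) : Algorithm n
  | coin (μ : PMF ℕ) (next : ℕ → Algorithm n) : Algorithm n
  | sampleP (next : Fin n → Algorithm n) : Algorithm n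
  | sampleQ (next : Fin n → Algorithm n) : Algorithm n

/-- The distribution of the output, when the oracles return independent samples
from `p` and `q`. -/
noncomputable def Algorithm.run {n : ℕ} (p q : PMF (Fin n)) : Algorithm n → PMF Bool
  | .output b => PMF.pure b
  | .coin μ next => μ.bind fun j => (next j).run p q
  | .sampleP next => p.bind fun x => (next x).run p q
  | .sampleQ next => q.bind fun x => (next x).run p q

/-- In every execution the algorithm requests at most `s` samples, those from `p` and those
from `q` counted together. -/
def Algorithm.DrawsAtMost {n : ℕ} : Algorithm n → ℕ → Prop
  | .output _, _ => True
  | .coin _ next, s => ∀ j, (next j).DrawsAtMost s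
  | .sampleP _, 0 => False
  | .sampleP next, s + 1 => ∀ x, (next x).DrawsAtMost s
  | .sampleQ _, 0 => False
  | .sampleQ next, s + 1 => ∀ x, (next x).DrawsAtMost s

/-- A closeness tester in the presence of the known noise `η`, with proximity parameter `ε`. -/
def IsClosenessTester {n : ℕ} (η : PMF (Fin n)) (ε : ℝ) (T : Algorithm n) : Prop :=
  ∀ p q : PMF (Fin n),
    (p ∈ mixtures q η → 2 / 3 ≤ T.run p q true) ∧
    (IsFar ε p (mixtures q η) → 2 / 3 ≤ T.run p q false)

end MixtureTesting

namespace MixtureTesting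

/-! Both bounds come from the two-point method with random instances: a tester drawing at most `s`
samples is a bounded function of `s` samples from each distribution, so the averaged sample laws of
accepted and rejected instances must be at `ℓ₁`-distance at least `1/3`
(`one_third_le_of_isClosenessTester`).

For `√n / ε²`, take `q` uniform, so that noise does nothing, and `p` uniform or perturbed by random
signs antisymmetrically on pairs of points. The `χ²`-divergence reduces to an exponential moment of
the overlap of two sign vectors (`uniformity_lower_bound`).

For `n^(2/3) / ε^(4/3)`, the domain contains `m = 2s` blocks of `M ≈ n/s` pairs. In each block, mass
`ε` is spread over all pairs, split `7/8 : 1/8` in a random orientation, and mass `1 - ε` sits on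
symmetric heavy pairs at random positions. Accepted instances have `p = q`; in rejected ones `q` has
all orientations reversed. Reversal shows only if two light samples share a pair, and heavy pairs
produce the same coincidence more often: converting both samples to an unused heavy index shows that
such configurations have relative weight of order `ε² / M` (`latent_term_le`,
`abs_blockLaw_sub_le`). Since `2s` samples fall into `2s` blocks, few share a block; summing squared
relative errors over blocks gives order `m ε⁴ / M²`, that is `s³ ε⁴ / n²`
(`sq_sum_abs_instanceLaw_sub_le`). Noise cannot undo the reversal, because half of the domain lies
outside the blocks and any uniform component is detected there (`isFar_instancePMF`). -/

/-- The sum over functions of a product over coordinates is the product of sums. -/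
lemma sum_pi_prod {ι R : Type*} {κ : ι → Type*} [Fintype ι] [DecidableEq ι] [∀ i, Fintype (κ i)]
    [CommSemiring R] (g : ∀ i, κ i → R) : ∑ x : ∀ i, κ i, ∏ i, g i (x i) = ∏ i, ∑ k, g i k := by
  rw [Finset.prod_univ_sum, Fintype.piFinset_univ]

/-! ### Reduction of testers to `ℓ₁`-distances of averaged sample laws -/

/-- The acceptance probability of an algorithm drawing at most `s` samples is the expectation of a
`[0, 1]`-valued function of `s` samples from each of the two distributions. -/
lemma exists_acceptance_function_ennreal {n : ℕ} {V : Type*} [Fintype V] (f : V → Fin n)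
    (T : Algorithm n) :
    ∀ s : ℕ, T.DrawsAtMost s →
      ∃ F : (Fin s → V) → (Fin s → V) → ENNReal, (∀ x y, F x y ≤ 1) ∧
        ∀ p q : PMF V, T.run (p.map f) (q.map f) true =
          ∑ x, ∑ y, (∏ i, p (x i)) * (∏ i, q (y i)) * F x y := by
  have hmass : ∀ p : PMF V, ∑ v, p v = 1 := fun p => by
    rw [← tsum_fintype (L := .unconditional V)]
    exact p.tsum_coe
  have hone : ∀ (s : ℕ) (p : PMF V), ∑ x : Fin s → V, ∏ i, p (x i) = 1 := by
    intro s p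
    rw [sum_pi_prod fun _ v => p v]
    simp [hmass p]
  have hcons : ∀ (s : ℕ) (p : PMF V) (G : V → (Fin s → V) → ENNReal),
      ∑ x : Fin (s + 1) → V, (∏ i, p (x i)) * G (x 0) (Fin.tail x) =
        ∑ v, p v * ∑ x : Fin s → V, (∏ i, p (x i)) * G v x := by
    intro s p G
    rw [← (Fin.consEquiv fun _ : Fin (s + 1) => V).sum_comp, Fintype.sum_prod_type]
    refine Finset.sum_congr rfl fun v _ => ?_
    rw [Finset.mul_sum]
    refine Finset.sum_congr rfl fun x _ => ?_
    simp [Fin.consEquiv, Fin.prod_univ_succ, mul_assoc]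
  have hdrop : ∀ (s : ℕ) (p : PMF V) (G : (Fin s → V) → ENNReal),
      ∑ x : Fin (s + 1) → V, (∏ i, p (x i)) * G (Fin.tail x) =
        ∑ x : Fin s → V, (∏ i, p (x i)) * G x := by
    intro s p G
    rw [hcons s p fun _ => G, ← Finset.sum_mul, hmass p, one_mul]
  induction T with
  | output b =>
    intro s _
    refine ⟨fun _ _ => if b = true then 1 else 0, fun _ _ => by dsimp; split_ifs <;> simp,
      fun p q => ?_⟩
    simp only [Algorithm.run, PMF.pure_apply, ← Finset.sum_mul, ← Finset.mul_sum, hone]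
    cases b <;> simp
  | coin μ next ih =>
    intro s hs
    choose F hF1 hF using fun j => ih j s (hs j)
    refine ⟨fun x y => ∑' j, μ j * F j x y, fun x y => ?_, fun p q => ?_⟩
    · calc ∑' j, μ j * F j x y ≤ ∑' j, μ j :=
            ENNReal.tsum_le_tsum fun j => mul_le_of_le_one_right' (hF1 j x y)
        _ = 1 := μ.tsum_coe
    · simp only [Algorithm.run, PMF.bind_apply, hF, ← ENNReal.tsum_mul_left, Finset.mul_sum]
      rw [Summable.tsum_finsetSum fun _ _ => ENNReal.summable]
      refine Finset.sum_congr rfl fun x _ => ?_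
      rw [Summable.tsum_finsetSum fun _ _ => ENNReal.summable]
      refine Finset.sum_congr rfl fun y _ => tsum_congr fun j => ?_
      ring
  | sampleP next ih =>
    intro s hs
    cases s with
    | zero => exact hs.elim
    | succ s =>
      choose F hF1 hF using fun j => ih j s (hs j)
      -- The head of `y` is discarded unread, so that both sequences keep the same length; it
      -- integrates to one.
      refine ⟨fun x y => F (f (x 0)) (Fin.tail x) (Fin.tail y), fun x y => hF1 _ _ _,
        fun p q => ?_⟩
      have h1 : ∀ x : Fin (s + 1) → V,
          ∑ y : Fin (s + 1) → V, (∏ i, p (x i)) * (∏ i, q (y i)) *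
            F (f (x 0)) (Fin.tail x) (Fin.tail y) =
          (∏ i, p (x i)) * ∑ y : Fin s → V, (∏ i, q (y i)) * F (f (x 0)) (Fin.tail x) y := by
        intro x
        rw [← hdrop s q, Finset.mul_sum]
        simp only [mul_assoc]
      simp only [h1]
      rw [hcons s p fun v x => ∑ y : Fin s → V, (∏ i, q (y i)) * F (f v) x y]
      simp only [Algorithm.run, PMF.bind_map, PMF.bind_apply, tsum_fintype, Function.comp, hF,
        Finset.mul_sum, mul_assoc]
  | sampleQ next ih =>
    intro s hs
    cases s with
    | zero => exact hs.elim
    | succ s =>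
      choose F hF1 hF using fun j => ih j s (hs j)
      refine ⟨fun x y => F (f (y 0)) (Fin.tail x) (Fin.tail y), fun x y => hF1 _ _ _,
        fun p q => ?_⟩
      have h1 : ∀ y : Fin (s + 1) → V,
          ∑ x : Fin (s + 1) → V, (∏ i, p (x i)) * (∏ i, q (y i)) *
            F (f (y 0)) (Fin.tail x) (Fin.tail y) =
          (∏ i, q (y i)) * ∑ x : Fin s → V, (∏ i, p (x i)) * F (f (y 0)) x (Fin.tail y) := by
        intro y
        rw [← hdrop s p fun x => F (f (y 0)) x (Fin.tail y), Finset.mul_sum]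
        exact Finset.sum_congr rfl fun x _ => by ring
      rw [Finset.sum_comm]
      simp only [h1]
      rw [hcons s q fun v y => ∑ x : Fin s → V, (∏ i, p (x i)) * F (f v) x y]
      simp only [Algorithm.run, PMF.bind_map, PMF.bind_apply, tsum_fintype, Function.comp, hF]
      refine Finset.sum_congr rfl fun v _ => ?_
      congr 1
      rw [Finset.sum_comm]
      refine Finset.sum_congr rfl fun y _ => ?_
      rw [Finset.mul_sum]
      exact Finset.sum_congr rfl fun x _ => by ring

/-- Real-valued form of `exists_acceptance_function_ennreal`. -/
lemma exists_acceptance_function {n s : ℕ} {V : Type*} [Fintype V] (f : V → Fin n)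
    (T : Algorithm n) (hs : T.DrawsAtMost s) :
    ∃ F : (Fin s → V) → (Fin s → V) → ℝ, (∀ x y, |F x y| ≤ 1) ∧
      ∀ p q : PMF V, (T.run (p.map f) (q.map f) true).toReal =
        ∑ x, ∑ y, (∏ i, (p (x i)).toReal) * (∏ i, (q (y i)).toReal) * F x y := by
  obtain ⟨F, hF1, hF⟩ := exists_acceptance_function_ennreal f T s hs
  refine ⟨fun x y => (F x y).toReal, fun x y => ?_, fun p q => ?_⟩
  · rw [abs_of_nonneg ENNReal.toReal_nonneg]
    exact ENNReal.toReal_le_of_le_ofReal zero_le_one (by simpa using hF1 x y)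
  · have hne : ∀ x y, (∏ i, p (x i)) * (∏ i, q (y i)) * F x y ≠ ⊤ := fun x y =>
      ENNReal.mul_ne_top (ENNReal.mul_ne_top
        (ENNReal.prod_ne_top fun i _ => p.apply_ne_top _)
        (ENNReal.prod_ne_top fun i _ => q.apply_ne_top _))
        (ne_top_of_le_ne_top ENNReal.one_ne_top (hF1 x y))
    rw [hF, ENNReal.toReal_sum fun x _ => ENNReal.sum_ne_top.2 fun y _ => hne x y]
    refine Finset.sum_congr rfl fun x _ => ?_
    rw [ENNReal.toReal_sum fun y _ => hne x y]
    refine Finset.sum_congr rfl fun y _ => ?_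
    simp [ENNReal.toReal_mul, ENNReal.toReal_prod]

/-- Two-point method for mixtures: a tester needs enough samples for the averaged sample laws of
accepted and rejected instances to be separated. -/
lemma one_third_le_of_isClosenessTester {n s : ℕ} {η : PMF (Fin n)} {ε : ℝ} {T : Algorithm n}
    (hT : IsClosenessTester η ε T) (hs : T.DrawsAtMost s) {V Θ : Type*} [Fintype V] [Fintype Θ]
    [Nonempty Θ] (f : V → Fin n) (p₀ q₀ p₁ q₁ : Θ → PMF V)
    (hyes : ∀ θ, (p₀ θ).map f ∈ mixtures ((q₀ θ).map f) η)
    (hno : ∀ θ, IsFar ε ((p₁ θ).map f) (mixtures ((q₁ θ).map f) η)) :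
    1 / 3 ≤ ∑ x : Fin s → V, ∑ y : Fin s → V,
      |(Fintype.card Θ : ℝ)⁻¹ * ∑ θ, (∏ i, (p₀ θ (x i)).toReal) * (∏ i, (q₀ θ (y i)).toReal) -
       (Fintype.card Θ : ℝ)⁻¹ * ∑ θ, (∏ i, (p₁ θ (x i)).toReal) * (∏ i, (q₁ θ (y i)).toReal)| := by
  obtain ⟨F, hF1, hF⟩ := exists_acceptance_function f T hs
  have hcard : (0 : ℝ) < Fintype.card Θ := by exact_mod_cast Fintype.card_pos
  have hgap : ∀ θ, 1 / 3 ≤ (T.run ((p₀ θ).map f) ((q₀ θ).map f) true).toReal -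
      (T.run ((p₁ θ).map f) ((q₁ θ).map f) true).toReal := by
    intro θ
    have h0 := (hT ((p₀ θ).map f) ((q₀ θ).map f)).1 (hyes θ)
    have h1 := (hT ((p₁ θ).map f) ((q₁ θ).map f)).2 (hno θ)
    set P := T.run ((p₀ θ).map f) ((q₀ θ).map f)
    set Q := T.run ((p₁ θ).map f) ((q₁ θ).map f)
    have hQ : (Q true).toReal + (Q false).toReal = 1 := by
      have := Q.tsum_coe
      rw [tsum_fintype, Fintype.sum_bool] at this
      rw [← ENNReal.toReal_add (Q.apply_ne_top _) (Q.apply_ne_top _), this, ENNReal.toReal_one]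
    have h23 : (2 / 3 : ENNReal).toReal = 2 / 3 := by simp
    have h0' := ENNReal.toReal_mono (P.apply_ne_top _) h0
    have h1' := ENNReal.toReal_mono (Q.apply_ne_top _) h1
    rw [h23] at h0' h1'
    linarith
  have havg : 1 / 3 ≤ (Fintype.card Θ : ℝ)⁻¹ * ∑ θ,
      ((T.run ((p₀ θ).map f) ((q₀ θ).map f) true).toReal -
      (T.run ((p₁ θ).map f) ((q₁ θ).map f) true).toReal) := by
    have := Finset.card_nsmul_le_sum Finset.univ _ (1 / 3 : ℝ) fun θ _ => hgap θ
    rw [inv_mul_eq_div, le_div_iff₀ hcard]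
    simpa [mul_comm] using this
  refine havg.trans ?_
  simp only [hF]
  have : (Fintype.card Θ : ℝ)⁻¹ * ∑ θ,
      ((∑ x : Fin s → V, ∑ y : Fin s → V,
        (∏ i, (p₀ θ (x i)).toReal) * (∏ i, (q₀ θ (y i)).toReal) * F x y) -
      ∑ x : Fin s → V, ∑ y : Fin s → V,
        (∏ i, (p₁ θ (x i)).toReal) * (∏ i, (q₁ θ (y i)).toReal) * F x y) =
      ∑ x : Fin s → V, ∑ y : Fin s → V,
      ((Fintype.card Θ : ℝ)⁻¹ * ∑ θ, (∏ i, (p₀ θ (x i)).toReal) * (∏ i, (q₀ θ (y i)).toReal) -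
       (Fintype.card Θ : ℝ)⁻¹ * ∑ θ, (∏ i, (p₁ θ (x i)).toReal) * (∏ i, (q₁ θ (y i)).toReal))
        * F x y := by
    simp only [← Finset.sum_sub_distrib, ← mul_sub, ← sub_mul]
    rw [Finset.sum_comm, Finset.mul_sum]
    refine Finset.sum_congr rfl fun x _ => ?_
    rw [Finset.sum_comm, Finset.mul_sum]
    refine Finset.sum_congr rfl fun y _ => ?_
    rw [← Finset.sum_mul, mul_assoc]
  rw [this]
  refine Finset.sum_le_sum fun x _ => Finset.sum_le_sum fun y _ => ?_
  refine (le_abs_self _).trans ?_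
  rw [abs_mul]
  exact mul_le_of_le_one_right (abs_nonneg _) (hF1 x y)

/-! ### Real mass functions, test functions and the `χ²` bound -/

/-- The distribution with a given nonnegative real mass function. -/
noncomputable def ofRealMass {V : Type*} [Fintype V] (d : V → ℝ) (h0 : ∀ v, 0 ≤ d v)
    (h1 : ∑ v, d v = 1) : PMF V :=
  PMF.ofFintype (fun v => ENNReal.ofReal (d v)) (by
    rw [← ENNReal.ofReal_sum_of_nonneg fun v _ => h0 v, h1, ENNReal.ofReal_one])

@[simp] lemma toReal_ofRealMass {V : Type*} [Fintype V] (d : V → ℝ) (h0 : ∀ v, 0 ≤ d v)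
    (h1 : ∑ v, d v = 1) (v : V) : (ofRealMass d h0 h1 v).toReal = d v := by
  simp [ofRealMass, h0 v]

lemma sum_map_toReal_mul {V : Type*} [Fintype V] {n : ℕ} (p : PMF V) (f : V → Fin n)
    (g : Fin n → ℝ) :
    ∑ x, (p.map f x).toReal * g x = ∑ v, (p v).toReal * g (f v) := by
  classical
  have h : ∀ x, (p.map f x).toReal = ∑ v, if x = f v then (p v).toReal else 0 := by
    intro x
    rw [PMF.map_apply, tsum_fintype, ENNReal.toReal_sum]
    · exact Finset.sum_congr rfl fun v _ => by split_ifs <;> simp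
    · intro v _
      split_ifs
      · exact p.apply_ne_top _
      · simp
  simp only [h, Finset.sum_mul]
  rw [Finset.sum_comm]
  refine Finset.sum_congr rfl fun v _ => ?_
  simp [ite_mul]

/-- A test function bounded by one bounds the `ℓ₁`-distance from below. -/
lemma sum_mul_sub_le_l1Dist {n : ℕ} (p r : PMF (Fin n)) (φ : Fin n → ℝ) (hφ : ∀ x, |φ x| ≤ 1) :
    ∑ x, (p x).toReal * φ x - ∑ x, (r x).toReal * φ x ≤ l1Dist p r := by
  rw [← Finset.sum_sub_distrib, l1Dist]
  refine Finset.sum_le_sum fun x _ => ?_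
  rw [← sub_mul]
  refine (le_abs_self _).trans ?_
  rw [abs_mul]
  exact mul_le_of_le_one_right (abs_nonneg _) (hφ x)

/-- The squared `ℓ₁`-distance is at most the `χ²`-divergence. -/
lemma sq_sum_abs_sub_le {Ω : Type*} [Fintype Ω] (P Q : Ω → ℝ) (hP : ∑ x, P x = 1)
    (hQ : ∑ x, Q x = 1) (hQ0 : ∀ x, 0 ≤ Q x) (hPQ : ∀ x, Q x = 0 → P x = 0) :
    (∑ x, |P x - Q x|) ^ 2 ≤ ∑ x, P x ^ 2 / Q x - 1 := by
  have h1 : ∀ x, P x ^ 2 / Q x - 2 * P x + Q x = (P x - Q x) ^ 2 / Q x := by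
    intro x
    rcases eq_or_ne (Q x) 0 with h | h
    · simp [h, hPQ x h]
    · field_simp
      ring
  -- Cauchy–Schwarz for `|P - Q|² = Q · ((P - Q)² / Q)`.
  have h2 := Finset.sum_sq_le_sum_mul_sum_of_sq_le_mul Finset.univ (r := fun x => |P x - Q x|)
    (f := Q) (g := fun x => (P x - Q x) ^ 2 / Q x) (fun x _ => hQ0 x)
    (fun x _ => div_nonneg (sq_nonneg _) (hQ0 x)) (fun x _ => by
      rcases eq_or_ne (Q x) 0 with h | h
      · simp [h, hPQ x h]
      · rw [sq_abs, mul_div_cancel₀ _ h])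
  rw [hQ, one_mul] at h2
  refine h2.trans (le_of_eq ?_)
  simp only [← h1]
  rw [Finset.sum_add_distrib, Finset.sum_sub_distrib, ← Finset.mul_sum, hP, hQ]
  ring

/-! ### Uniformity testing: random signs on pairs -/

/-- The real sign of a Boolean. -/
def boolSign (b : Bool) : ℝ := if b then 1 else -1

lemma abs_boolSign (b : Bool) : |boolSign b| = 1 := by cases b <;> simp [boolSign]

/-- The perturbation of the uniform mass function: antisymmetric on each of `m` pairs, with the
signs `z`, and zero elsewhere. -/
def pairPerturbation {m r : ℕ} (z : Fin m → Bool) : (Fin m × Bool) ⊕ Fin r → ℝ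
  | .inl (j, b) => boolSign (z j) * boolSign b
  | .inr _ => 0

lemma abs_pairPerturbation_le {m r : ℕ} (z : Fin m → Bool) (v : (Fin m × Bool) ⊕ Fin r) :
    |pairPerturbation z v| ≤ 1 := by
  rcases v with ⟨j, b⟩ | _ <;> simp [pairPerturbation, abs_mul, abs_boolSign]

lemma sum_pairPerturbation {m r : ℕ} (z : Fin m → Bool) :
    ∑ v : (Fin m × Bool) ⊕ Fin r, pairPerturbation z v = 0 := by
  simp [Fintype.sum_sum_type, Fintype.sum_prod_type, pairPerturbation, boolSign]

lemma sum_pairPerturbation_mul {m r : ℕ} (z z' : Fin m → Bool) :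
    ∑ v : (Fin m × Bool) ⊕ Fin r, pairPerturbation z v * pairPerturbation z' v =
      2 * ∑ j, boolSign (z j) * boolSign (z' j) := by
  simp only [Fintype.sum_sum_type, Fintype.sum_prod_type, pairPerturbation, boolSign,
    Fintype.sum_bool, Finset.mul_sum]
  simp only [mul_zero, Finset.sum_const_zero, add_zero]
  refine Finset.sum_congr rfl fun j _ => ?_
  cases z j <;> cases z' j <;> norm_num

/-- The exponential moment of the overlap of two independent uniform sign vectors. -/
lemma sum_exp_overlap_le (m : ℕ) (a : ℝ) :
    ((2 : ℝ) ^ m)⁻¹ * ∑ z : Fin m → Bool, ((2 : ℝ) ^ m)⁻¹ * ∑ z' : Fin m → Bool,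
      Real.exp (a * ∑ j, boolSign (z j) * boolSign (z' j)) ≤ Real.exp (m * (a ^ 2 / 2)) := by
  -- The sign of `z j` only exchanges the two terms of `2 cosh a`, so the inner sum does not depend
  -- on `z`.
  have h1 : ∀ z : Fin m → Bool, ∑ z' : Fin m → Bool,
      Real.exp (a * ∑ j, boolSign (z j) * boolSign (z' j)) = 2 ^ m * Real.cosh a ^ m := by
    intro z
    simp only [Finset.mul_sum, Real.exp_sum]
    rw [sum_pi_prod fun j b => Real.exp (a * (boolSign (z j) * boolSign b)), ← mul_pow]
    rw [Finset.prod_congr rfl (g := fun _ => 2 * Real.cosh a), Finset.prod_const,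
      Finset.card_univ, Fintype.card_fin]
    intro j _
    rw [Fintype.sum_bool, Real.cosh_eq]
    cases z j <;> simp [boolSign] <;> ring
  simp only [h1]
  rw [Finset.sum_const, Finset.card_univ, Fintype.card_pi]
  simp only [Fintype.card_bool, Finset.prod_const, Finset.card_univ, Fintype.card_fin,
    nsmul_eq_mul]
  push_cast
  have h2 : (2 : ℝ) ^ m ≠ 0 := by positivity
  rw [inv_mul_cancel_left₀ h2, inv_mul_cancel_left₀ h2, Real.exp_nat_mul]
  exact pow_le_pow_left₀ (Real.cosh_pos a).le (Real.cosh_le_exp_half_sq a) m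

/-- The law of `s` samples from a randomly perturbed uniform distribution is close to uniform. -/
lemma sq_sum_abs_perturbed_sub_uniform_le {m r n : ℕ} (s : ℕ) (hn : 2 * m + r = n) (hn0 : 0 < n)
    {e : ℝ} (he0 : 0 ≤ e) (he1 : e ≤ 1) :
    (∑ x : Fin s → (Fin m × Bool) ⊕ Fin r,
      |((2 : ℝ) ^ m)⁻¹ * ∑ z : Fin m → Bool, (∏ i, (1 + e * pairPerturbation z (x i)) / n) -
        ∏ _i : Fin s, (1 / n : ℝ)|) ^ 2 ≤ Real.exp ((s : ℝ) ^ 2 * e ^ 4 / n) - 1 := by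
  have hnR : (0 : ℝ) < n := by exact_mod_cast hn0
  have hcard : Fintype.card ((Fin m × Bool) ⊕ Fin r) = n := by simp; omega
  have hsum1 : ∀ z : Fin m → Bool,
      ∑ v : (Fin m × Bool) ⊕ Fin r, (1 + e * pairPerturbation z v) / n = 1 := by
    intro z
    rw [← Finset.sum_div, Finset.sum_add_distrib, ← Finset.mul_sum, sum_pairPerturbation,
      Finset.sum_const, Finset.card_univ, hcard]
    simp [hnR.ne']
  have h2 : (2 : ℝ) ^ m ≠ 0 := by positivity
  have hcardz : Fintype.card (Fin m → Bool) = 2 ^ m := by simp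
  refine (sq_sum_abs_sub_le _ _ ?_ ?_ (fun x => Finset.prod_nonneg fun i _ => by positivity)
    fun x h => ?_).trans ?_
  · rw [← Finset.mul_sum, Finset.sum_comm]
    have : ∀ z : Fin m → Bool, ∑ x : Fin s → (Fin m × Bool) ⊕ Fin r,
        ∏ i, (1 + e * pairPerturbation z (x i)) / n = 1 := by
      intro z
      rw [sum_pi_prod fun _ v => (1 + e * pairPerturbation z v) / n]
      simp [hsum1]
    simp only [this, Finset.sum_const, Finset.card_univ, hcardz, nsmul_eq_mul]
    push_cast
    field_simp
  · rw [sum_pi_prod fun _ _ => (1 / n : ℝ)]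
    simp only [Finset.sum_const, Finset.card_univ, hcard, nsmul_eq_mul]
    simp [hnR.ne']
  · exact absurd h (Finset.prod_ne_zero_iff.2 fun i _ => by positivity)
  -- The squared average over `z` is an average over two independent copies `z`, `z'`; the sum over
  -- samples then factorizes and only their overlap remains.
  · have hkey : ∀ x : Fin s → (Fin m × Bool) ⊕ Fin r,
        (((2 : ℝ) ^ m)⁻¹ * ∑ z : Fin m → Bool, (∏ i, (1 + e * pairPerturbation z (x i)) / n)) ^ 2 /
          ∏ _i : Fin s, (1 / n : ℝ) =
        ((2 : ℝ) ^ m)⁻¹ * ∑ z : Fin m → Bool, ((2 : ℝ) ^ m)⁻¹ * ∑ z' : Fin m → Bool,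
          ∏ i, (1 + e * pairPerturbation z (x i)) * (1 + e * pairPerturbation z' (x i)) / n := by
      intro x
      rw [pow_two, ← Finset.mul_sum, mul_mul_mul_comm, Finset.sum_mul_sum, ← mul_assoc,
        mul_div_assoc, Finset.sum_div]
      congr 1
      refine Finset.sum_congr rfl fun z _ => ?_
      rw [Finset.sum_div]
      refine Finset.sum_congr rfl fun z' _ => ?_
      rw [← Finset.prod_mul_distrib, ← Finset.prod_div_distrib]
      refine Finset.prod_congr rfl fun i _ => ?_
      field_simp
    simp only [hkey]
    refine sub_le_sub_right ?_ 1
    rw [← Finset.mul_sum, Finset.sum_comm]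
    have hswap : ∀ z : Fin m → Bool,
        ∑ x : Fin s → (Fin m × Bool) ⊕ Fin r, ((2 : ℝ) ^ m)⁻¹ * ∑ z' : Fin m → Bool,
          ∏ i, (1 + e * pairPerturbation z (x i)) * (1 + e * pairPerturbation z' (x i)) / n =
        ((2 : ℝ) ^ m)⁻¹ * ∑ z' : Fin m → Bool,
          (1 + e ^ 2 * 2 / n * ∑ j, boolSign (z j) * boolSign (z' j)) ^ s := by
      intro z
      rw [← Finset.mul_sum, Finset.sum_comm]
      congr 1
      refine Finset.sum_congr rfl fun z' _ => ?_
      rw [sum_pi_prod fun _ v =>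
        (1 + e * pairPerturbation z v) * (1 + e * pairPerturbation z' v) / (n : ℝ),
        Finset.prod_const, Finset.card_univ, Fintype.card_fin]
      congr 1
      have : ∀ v : (Fin m × Bool) ⊕ Fin r,
          (1 + e * pairPerturbation z v) * (1 + e * pairPerturbation z' v) / (n : ℝ) =
          (1 + e * pairPerturbation z v) / n + e / n * pairPerturbation z' v +
            e ^ 2 / n * (pairPerturbation z v * pairPerturbation z' v) := by
        intro v
        field_simp
        ring
      simp only [this, Finset.sum_add_distrib, ← Finset.mul_sum, hsum1, sum_pairPerturbation,
        sum_pairPerturbation_mul]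
      ring
    simp only [hswap]
    calc _ ≤ ((2 : ℝ) ^ m)⁻¹ * ∑ z : Fin m → Bool, ((2 : ℝ) ^ m)⁻¹ * ∑ z' : Fin m → Bool,
          Real.exp (s * (e ^ 2 * 2 / n) * ∑ j, boolSign (z j) * boolSign (z' j)) := by
          gcongr with z _ z' _
          have habs : |∑ j, boolSign (z j) * boolSign (z' j)| ≤ m := by
            refine (Finset.abs_sum_le_sum_abs _ _).trans ?_
            simp [abs_mul, abs_boolSign]
          have hm : (2 : ℝ) * m ≤ n := by exact_mod_cast (by omega : 2 * m ≤ n)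
          have hc : 0 ≤ e ^ 2 * 2 / n := by positivity
          have hc1 : e ^ 2 * 2 / n * m ≤ 1 := by
            rw [div_mul_eq_mul_div, div_le_one hnR]
            nlinarith [pow_le_one₀ he0 he1 (n := 2)]
          -- Nonnegativity is needed to raise `1 + t ≤ exp t` to the power `s`.
          have hbase : 0 ≤ 1 + e ^ 2 * 2 / n * ∑ j, boolSign (z j) * boolSign (z' j) := by
            nlinarith [mul_le_mul_of_nonneg_left (neg_le_of_abs_le habs) hc]
          rw [mul_assoc, Real.exp_nat_mul]
          refine pow_le_pow_left₀ hbase ?_ s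
          rw [add_comm]
          exact Real.add_one_le_exp _
      _ ≤ _ := sum_exp_overlap_le m _
      _ ≤ _ := by
          refine Real.exp_le_exp.2 ?_
          have hm : (2 : ℝ) * m ≤ n := by exact_mod_cast (by omega : 2 * m ≤ n)
          rw [le_div_iff₀ hnR]
          have : (m : ℝ) * ((s * (e ^ 2 * 2 / n)) ^ 2 / 2) * n =
              (s : ℝ) ^ 2 * e ^ 4 * (2 * m / n) := by
            field_simp
          rw [this]
          refine mul_le_of_le_one_right (by positivity) ?_
          rwa [div_le_one hnR]

/-- The uniformity-testing lower bound. -/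
lemma uniformity_lower_bound {n s : ℕ} [NeZero n] (hn : 2 ≤ n) {ε : ℝ} (h0 : 0 < ε)
    (h1 : ε ≤ 1 / 2) {T : Algorithm n}
    (hT : IsClosenessTester (PMF.uniformOfFintype (Fin n)) ε T) (hs : T.DrawsAtMost s) :
    (n : ℝ) ≤ 100 * (s : ℝ) ^ 2 * ε ^ 4 := by
  set m := n / 2
  set r := n % 2
  have hmr : 2 * m + r = n := Nat.div_add_mod n 2
  have hn0 : 0 < n := by omega
  have hnR : (0 : ℝ) < n := by exact_mod_cast hn0
  have hm3 : (n : ℝ) ≤ 3 * m := by exact_mod_cast (by omega : n ≤ 3 * m)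
  set V := (Fin m × Bool) ⊕ Fin r
  have hcard : Fintype.card V = n := by simp [V]; omega
  let f : V ≃ Fin n := Fintype.equivFinOfCardEq hcard
  -- The perturbed law is at distance `2me / n` from uniform. For odd `n` only `2m ≥ 2n/3` points
  -- are perturbed, hence the factor `3/2`.
  set e : ℝ := 3 / 2 * ε with he
  have he0 : 0 ≤ e := by positivity
  have he1 : e ≤ 1 := by linarith
  let u : PMF V := ofRealMass (fun _ => 1 / n) (fun _ => by positivity) (by
    rw [Finset.sum_const, Finset.card_univ, hcard, nsmul_eq_mul]
    field_simp)
  have hpert : ∀ (z : Fin m → Bool) (v : V), -1 ≤ e * pairPerturbation z v := by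
    intro z v
    have := abs_le.1 (abs_pairPerturbation_le z v)
    nlinarith
  let p : (Fin m → Bool) → PMF V := fun z => ofRealMass
    (fun v => (1 + e * pairPerturbation z v) / n)
    (fun v => div_nonneg (by linarith [hpert z v]) hnR.le) (by
      rw [← Finset.sum_div, Finset.sum_add_distrib, ← Finset.mul_sum, sum_pairPerturbation,
        Finset.sum_const, Finset.card_univ, hcard]
      simp [hnR.ne'])
  have hmap : ∀ (d : PMF V) (x : Fin n), (d.map f x).toReal = (d (f.symm x)).toReal := by
    intro d x
    congr 1
    rw [PMF.map_apply, tsum_eq_single (f.symm x)]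
    · simp
    · intro v hv
      rw [if_neg]
      rintro rfl
      simp at hv
  have hunif : ∀ x : Fin n, (PMF.uniformOfFintype (Fin n) x).toReal = 1 / n := by
    intro x
    simp
  have hmix : ∀ ρ ∈ mixtures (u.map f) (PMF.uniformOfFintype (Fin n)), ∀ x, (ρ x).toReal = 1 / n := by
    rintro ρ ⟨α, -, hα⟩ x
    rw [hα, hmap, hunif]
    simp only [u, toReal_ofRealMass]
    ring
  have key := one_third_le_of_isClosenessTester hT hs f (fun _ => u) (fun _ => u) p (fun _ => u)
    (fun _ => ⟨0, by simp, fun x => by simp⟩) (fun z ρ hρ => by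
      have hφ := sum_mul_sub_le_l1Dist ((p z).map f) ρ
        (fun x => pairPerturbation z (f.symm x)) (fun x => abs_pairPerturbation_le z _)
      refine le_trans ?_ hφ
      simp only [hmix ρ hρ, hmap]
      rw [f.symm.sum_comp fun v => (p z v).toReal * pairPerturbation z v,
        f.symm.sum_comp fun v => 1 / (n : ℝ) * pairPerturbation z v, ← Finset.mul_sum,
        sum_pairPerturbation]
      have : ∀ v : V, (p z v).toReal * pairPerturbation z v = 1 / n * pairPerturbation z v +
          e / n * (pairPerturbation z v * pairPerturbation z v) := by
        intro v
        simp only [p, toReal_ofRealMass]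
        ring
      have hz0 : ∑ v : V, pairPerturbation z v = 0 := sum_pairPerturbation z
      have hz1 : ∑ v : V, pairPerturbation z v * pairPerturbation z v = _ :=
        sum_pairPerturbation_mul z z
      have hsq : ∀ j, boolSign (z j) * boolSign (z j) = 1 := fun j => by
        cases z j <;> simp [boolSign]
      simp only [hsq, Finset.sum_const, Finset.card_univ, Fintype.card_fin, nsmul_eq_mul,
        mul_one] at hz1
      simp only [this, Finset.sum_add_distrib]
      rw [← Finset.mul_sum, ← Finset.mul_sum, hz0, hz1, mul_zero, zero_add, sub_zero]
      rw [div_mul_eq_mul_div, le_div_iff₀ hnR, he]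
      nlinarith)
  have hu1 : ∑ y : Fin s → V, ∏ i, (u (y i)).toReal = 1 := by
    rw [sum_pi_prod fun _ v => (u v).toReal]
    simp only [u, toReal_ofRealMass, Finset.sum_const, Finset.card_univ, hcard, nsmul_eq_mul]
    simp [hnR.ne']
  have h2 : (2 : ℝ) ^ m ≠ 0 := by positivity
  have hcardz : (Fintype.card (Fin m → Bool) : ℝ) = 2 ^ m := by simp
  have hbound := sq_sum_abs_perturbed_sub_uniform_le s hmr hn0 he0 he1
  have hEq : ∑ x : Fin s → V, ∑ y : Fin s → V,
      |(Fintype.card (Fin m → Bool) : ℝ)⁻¹ * ∑ _z : Fin m → Bool,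
          (∏ i, (u (x i)).toReal) * (∏ i, (u (y i)).toReal) -
       (Fintype.card (Fin m → Bool) : ℝ)⁻¹ * ∑ z,
          (∏ i, (p z (x i)).toReal) * (∏ i, (u (y i)).toReal)| =
      ∑ x : Fin s → V, |((2 : ℝ) ^ m)⁻¹ * ∑ z : Fin m → Bool,
        (∏ i, (1 + e * pairPerturbation z (x i)) / n) - ∏ _i : Fin s, (1 / n : ℝ)| := by
    refine Finset.sum_congr rfl fun x _ => ?_
    have : ∀ y : Fin s → V,
        |(Fintype.card (Fin m → Bool) : ℝ)⁻¹ * ∑ _z : Fin m → Bool,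
            (∏ i, (u (x i)).toReal) * (∏ i, (u (y i)).toReal) -
         (Fintype.card (Fin m → Bool) : ℝ)⁻¹ * ∑ z,
            (∏ i, (p z (x i)).toReal) * (∏ i, (u (y i)).toReal)| =
        |((2 : ℝ) ^ m)⁻¹ * ∑ z : Fin m → Bool,
          (∏ i, (1 + e * pairPerturbation z (x i)) / n) - ∏ _i : Fin s, (1 / n : ℝ)| *
          ∏ i, (u (y i)).toReal := by
      intro y
      have hy : 0 ≤ ∏ i, (u (y i)).toReal := Finset.prod_nonneg fun i _ => ENNReal.toReal_nonneg
      conv_rhs => rw [← abs_of_nonneg hy, ← abs_mul]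
      rw [abs_sub_comm, ← Finset.sum_mul, Finset.sum_const, Finset.card_univ, nsmul_eq_mul,
        inv_mul_cancel_left₀ (by rw [hcardz]; exact h2), hcardz, ← mul_assoc, ← sub_mul]
      simp only [u, p, toReal_ofRealMass]
    rw [Finset.sum_congr rfl fun y _ => this y, ← Finset.mul_sum, hu1, mul_one]
  rw [hEq] at key
  set t := ∑ x : Fin s → V, |((2 : ℝ) ^ m)⁻¹ * ∑ z : Fin m → Bool,
        (∏ i, (1 + e * pairPerturbation z (x i)) / n) - ∏ _i : Fin s, (1 / n : ℝ)|
  have h19 : (1 / 9 : ℝ) ≤ t ^ 2 := by nlinarith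
  set w := (s : ℝ) ^ 2 * e ^ 4 / n with hw
  -- For `w < 1/10`, `exp w - 1 < 10/9 - 1 = 1/9`, contrary to `1/9 ≤ t²`.
  have hwb : 1 / 10 ≤ w := by
    by_contra hlt
    push Not at hlt
    have hexp := Real.exp_bound_div_one_sub_of_interval (x := w) (by positivity) (by linarith)
    have : 1 / (1 - w) < 10 / 9 := by
      rw [div_lt_iff₀ (by linarith)]
      linarith
    linarith
  rw [hw, le_div_iff₀ hnR] at hwb
  have : e ^ 4 = 81 / 16 * ε ^ 4 := by rw [he]; ring
  rw [this] at hwb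
  nlinarith [show 0 ≤ (s : ℝ) ^ 2 * ε ^ 4 by positivity]

/-! ### Random blocks: light pairs masked by heavy pairs -/

/-- The conditional mass of an element of a light pair. -/
noncomputable def lightMass (b : Bool) : ℝ := if b then 1 / 8 else 7 / 8

lemma lightMass_pos (b : Bool) : 0 < lightMass b := by cases b <;> norm_num [lightMass]

lemma lightMass_le_one (b : Bool) : lightMass b ≤ 1 := by cases b <;> norm_num [lightMass]

lemma lightMass_le (b b' : Bool) : lightMass b ≤ 8 * lightMass b' := by
  cases b <;> cases b' <;> norm_num [lightMass]

/-- The mass of the latent component of a sample: light (`none`) or the heavy pair of a given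
index. -/
def latentMass {D : ℕ} (ε : ℝ) (w : Fin D → ℝ) : Option (Fin D) → ℝ
  | none => ε
  | some g => (1 - ε) * w g

/-- The factor of the conditional mass that depends on the positions `h` of the heavy pairs. -/
noncomputable def heavyKernel {D M : ℕ} (h : Fin D → Fin M) :
    Option (Fin D) → Fin M × Bool → ℝ
  | none, _ => 1
  | some g, y => if y.1 = h g then 1 / 2 else 0

/-- The factor of the conditional mass that depends on the orientations `z` of the light pairs;
`σ` reverses all orientations. -/
noncomputable def lightKernel {D M : ℕ} (z : Fin M → Bool) (σ : Bool) :
    Option (Fin D) → Fin M × Bool → ℝ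
  | none, y => lightMass (y.2 ^^ (z y.1 ^^ σ)) / M
  | some _, _ => 1

/-- The mass function of one block: heavy pairs at the positions `h`, carrying mass `1 - ε` in
proportions `w`, and light pairs oriented by `z`, carrying mass `ε`. -/
noncomputable def blockMass {D M : ℕ} (ε : ℝ) (w : Fin D → ℝ)
    (θ : (Fin D → Fin M) × (Fin M → Bool)) (σ : Bool) (y : Fin M × Bool) : ℝ :=
  ∑ a, latentMass ε w a * (heavyKernel θ.1 a y * lightKernel θ.2 σ a y)

/-- The law of samples from a random block; the sample `i` comes from the block with orientations
reversed if `c i` holds. -/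
noncomputable def blockLaw {D M : ℕ} {A : Type*} [Fintype A] (ε : ℝ) (w : Fin D → ℝ)
    (c : A → Bool) (y : A → Fin M × Bool) : ℝ :=
  (Fintype.card ((Fin D → Fin M) × (Fin M → Bool)) : ℝ)⁻¹ *
    ∑ θ : (Fin D → Fin M) × (Fin M → Bool), ∏ i, blockMass ε w θ (c i) (y i)

section

lemma latentMass_none {D : ℕ} (ε : ℝ) (w : Fin D → ℝ) : latentMass ε w none = ε := rfl

lemma latentMass_some {D : ℕ} (ε : ℝ) (w : Fin D → ℝ) (g : Fin D) :
    latentMass ε w (some g) = (1 - ε) * w g := rfl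

variable {D M : ℕ} {A : Type*} [Fintype A]

lemma heavyKernel_none (h : Fin D → Fin M) (y : Fin M × Bool) : heavyKernel h none y = 1 := rfl

lemma heavyKernel_some (h : Fin D → Fin M) (g : Fin D) (y : Fin M × Bool) :
    heavyKernel h (some g) y = if y.1 = h g then 1 / 2 else 0 := rfl

lemma lightKernel_none (z : Fin M → Bool) (σ : Bool) (y : Fin M × Bool) :
    lightKernel (D := D) z σ none y = lightMass (y.2 ^^ (z y.1 ^^ σ)) / M := rfl

lemma lightKernel_some (z : Fin M → Bool) (σ : Bool) (g : Fin D) (y : Fin M × Bool) :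
    lightKernel z σ (some g) y = 1 := rfl

lemma heavyKernel_nonneg (h : Fin D → Fin M) (a : Option (Fin D)) (y : Fin M × Bool) :
    0 ≤ heavyKernel h a y := by
  cases a
  · simp [heavyKernel]
  · simp only [heavyKernel]; split_ifs <;> norm_num

lemma lightKernel_nonneg (z : Fin M → Bool) (σ : Bool) (a : Option (Fin D)) (y : Fin M × Bool) :
    0 ≤ lightKernel z σ a y := by
  cases a
  · exact div_nonneg (lightMass_pos _).le (Nat.cast_nonneg _)
  · simp [lightKernel]

lemma latentMass_nonneg {ε : ℝ} {w : Fin D → ℝ} (h0 : 0 ≤ ε) (h1 : ε ≤ 1) (hw : ∀ g, 0 ≤ w g)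
    (a : Option (Fin D)) : 0 ≤ latentMass ε w a := by
  cases a
  · exact h0
  · exact mul_nonneg (by linarith) (hw _)

lemma blockMass_nonneg {ε : ℝ} {w : Fin D → ℝ} (h0 : 0 ≤ ε) (h1 : ε ≤ 1) (hw : ∀ g, 0 ≤ w g)
    (θ : (Fin D → Fin M) × (Fin M → Bool)) (σ : Bool) (y : Fin M × Bool) :
    0 ≤ blockMass ε w θ σ y :=
  Finset.sum_nonneg fun a _ => mul_nonneg (latentMass_nonneg h0 h1 hw a)
    (mul_nonneg (heavyKernel_nonneg _ _ _) (lightKernel_nonneg _ _ _ _))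

/-- The unnormalized law of the heavy part given the latent components. -/
noncomputable def heavyWeight (a : A → Option (Fin D)) (y : A → Fin M × Bool) : ℝ :=
  ∑ h : Fin D → Fin M, ∏ i, heavyKernel h (a i) (y i)

/-- The unnormalized law of the light part given the latent components. -/
noncomputable def lightWeight (c : A → Bool) (a : A → Option (Fin D)) (y : A → Fin M × Bool) : ℝ :=
  ∑ z : Fin M → Bool, ∏ i, lightKernel z (c i) (a i) (y i)

lemma heavyWeight_nonneg (a : A → Option (Fin D)) (y : A → Fin M × Bool) :
    0 ≤ heavyWeight a y :=
  Finset.sum_nonneg fun _ _ => Finset.prod_nonneg fun _ _ => heavyKernel_nonneg _ _ _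

lemma lightWeight_nonneg (c : A → Bool) (a : A → Option (Fin D)) (y : A → Fin M × Bool) :
    0 ≤ lightWeight c a y :=
  Finset.sum_nonneg fun _ _ => Finset.prod_nonneg fun _ _ => lightKernel_nonneg _ _ _ _

lemma blockLaw_eq [DecidableEq A] (ε : ℝ) (w : Fin D → ℝ) (c : A → Bool)
    (y : A → Fin M × Bool) :
    blockLaw ε w c y = (Fintype.card ((Fin D → Fin M) × (Fin M → Bool)) : ℝ)⁻¹ *
      ∑ a : A → Option (Fin D),
        (∏ i, latentMass ε w (a i)) * (heavyWeight a y * lightWeight c a y) := by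
  rw [blockLaw]
  congr 1
  simp only [blockMass]
  have : ∀ θ : (Fin D → Fin M) × (Fin M → Bool), ∏ i, ∑ a, latentMass ε w a *
      (heavyKernel θ.1 a (y i) * lightKernel θ.2 (c i) a (y i)) =
      ∑ a : A → Option (Fin D), (∏ i, latentMass ε w (a i)) *
        ((∏ i, heavyKernel θ.1 (a i) (y i)) * ∏ i, lightKernel θ.2 (c i) (a i) (y i)) := by
    intro θ
    rw [← sum_pi_prod fun i a => latentMass ε w a *
      (heavyKernel θ.1 a (y i) * lightKernel θ.2 (c i) a (y i))]
    simp only [Finset.prod_mul_distrib]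
  simp only [this]
  rw [Finset.sum_comm]
  refine Finset.sum_congr rfl fun a _ => ?_
  rw [← Finset.mul_sum, heavyWeight, lightWeight, Finset.sum_mul_sum, Fintype.sum_prod_type]

/-- If all light samples lie in different pairs, reversing orientations does not change the law. -/
lemma lightWeight_eq_of_injOn (c c' : A → Bool) (a : A → Option (Fin D)) (y : A → Fin M × Bool)
    (hinj : ∀ i j, a i = none → a j = none → (y i).1 = (y j).1 → i = j) :
    lightWeight c a y = lightWeight c' a y := by
  classical
  -- Flip exactly the pairs holding a light sample on which `c` and `c'` differ. As no pair holds
  -- two light samples, this is consistent, and it preserves the uniform law of `z`.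
  let t : Fin M → Bool := fun v => decide (∃ i, a i = none ∧ (y i).1 = v ∧ (c i ^^ c' i) = true)
  have ht : ∀ i, a i = none → t (y i).1 = (c i ^^ c' i) := by
    intro i hi
    by_cases hc : (c i ^^ c' i) = true
    · rw [hc]
      exact decide_eq_true ⟨i, hi, rfl, hc⟩
    · rw [Bool.eq_false_iff.2 hc]
      refine decide_eq_false ?_
      rintro ⟨j, hj, hji, hjc⟩
      rw [hinj j i hj hi hji] at hjc
      exact hc hjc
  let flip : (Fin M → Bool) → Fin M → Bool := fun z v => z v ^^ t v
  have hflip : Function.Involutive flip := fun z => by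
    funext v
    simp [flip]
  rw [lightWeight, lightWeight, ← Equiv.sum_comp hflip.toPerm]
  refine Finset.sum_congr rfl fun z _ => Finset.prod_congr rfl fun i _ => ?_
  cases hi : a i with
  | some g => rfl
  | none =>
    simp only [lightKernel, Function.Involutive.coe_toPerm, flip, ht i hi]
    cases c i <;> cases c' i <;> simp

/-- Among the first `card A` indices one is unused if some sample is light. -/
lemma exists_unused_index (a : A → Option (Fin D)) (hD : Fintype.card A ≤ D) {i : A}
    (hi : a i = none) : ∃ u : Fin D, (u : ℕ) < Fintype.card A ∧ ∀ l, a l ≠ some u := by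
  classical
  by_contra! hcon
  -- Otherwise `a` would take `card A + 1` values, namely `none` and the first `card A` indices.
  let e : Option (Fin (Fintype.card A)) → Option (Fin D) := Option.map (Fin.castLE hD)
  have he : Function.Injective e := Option.map_injective (Fin.castLE_injective hD)
  have hsub : Finset.univ.image e ⊆ Finset.univ.image a := by
    intro x hx
    simp only [Finset.mem_image, Finset.mem_univ, true_and] at hx ⊢
    obtain ⟨o, rfl⟩ := hx
    cases o with
    | none => exact ⟨i, hi⟩
    | some g => exact hcon (Fin.castLE hD g) g.2
  have h1 := Finset.card_le_card hsub
  rw [Finset.card_image_of_injective _ he, Finset.card_univ, Fintype.card_option,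
    Fintype.card_fin] at h1
  have h2 : (Finset.univ.image a).card ≤ Fintype.card A := Finset.card_image_le
  omega

variable [DecidableEq A]

/-- Replace the latent components of two samples. -/
def updatePair {β : Type*} (a : A → β) (i j : A) (b : β) : A → β :=
  Function.update (Function.update a i b) j b

/-- Cross-multiplied because the replaced factors may vanish. -/
lemma prod_updatePair {β : Type*} (g : A → β → ℝ) (a : A → β) {i j : A} (hij : i ≠ j) (b : β) :
    (∏ l, g l (updatePair a i j b l)) * (g i (a i) * g j (a j)) =
      (∏ l, g l (a l)) * (g i b * g j b) := by
  have hi : i ∈ Finset.univ.erase j := by simp [hij]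
  rw [← Finset.mul_prod_erase _ _ (Finset.mem_univ j), ← Finset.mul_prod_erase _ _ hi,
    ← Finset.mul_prod_erase _ (fun l => g l (a l)) (Finset.mem_univ j),
    ← Finset.mul_prod_erase _ (fun l => g l (a l)) hi]
  have : ∏ l ∈ (Finset.univ.erase j).erase i, g l (updatePair a i j b l) =
      ∏ l ∈ (Finset.univ.erase j).erase i, g l (a l) := by
    refine Finset.prod_congr rfl fun l hl => ?_
    simp only [Finset.mem_erase, Finset.mem_univ, and_true] at hl
    simp [updatePair, hl.1, hl.2]
  rw [this]
  simp only [updatePair, Function.update_self, Function.update_of_ne hij]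
  ring

/-- If `φ` does not depend on the coordinate `u`, fixing that coordinate divides its sum by the
number of values. -/
lemma sum_eq_mul_sum_ite (u : Fin D) (v : Fin M) (φ : (Fin D → Fin M) → ℝ)
    (hφ : ∀ h b, φ (Function.update h u b) = φ h) :
    ∑ h, φ h = M * ∑ h, if v = h u then φ h else 0 := by
  have h1 : ∀ b, ∑ h, (if b = h u then φ h else 0) = ∑ h, if v = h u then φ h else 0 := by
    intro b
    -- Exchanging the values `b` and `v` at the coordinate `u` shows that every value there
    -- contributes equally.
    let e : (Fin D → Fin M) → Fin D → Fin M :=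
      fun h => Function.update h u (Equiv.swap b v (h u))
    have he : Function.Involutive e := fun h => by simp [e]
    rw [← Equiv.sum_comp he.toPerm]
    refine Finset.sum_congr rfl fun h _ => ?_
    simp only [Function.Involutive.coe_toPerm, e, Function.update_self, hφ]
    have : b = Equiv.swap b v (h u) ↔ v = h u := by
      rw [eq_comm, Equiv.swap_apply_eq_iff, Equiv.swap_apply_left, eq_comm]
    simp only [this]
  calc ∑ h, φ h = ∑ h : Fin D → Fin M, ∑ b, if b = h u then φ h else 0 := by simp
    _ = _ := by rw [Finset.sum_comm]; simp [h1]

/-- Light samples do not constrain `h`. Once heavy with the unused index `u`, the two samples force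
`h u` to be their common pair, which holds for a fraction `1 / M` of all `h`, and contribute `1/2`
each. -/
lemma heavyWeight_eq_updatePair {a : A → Option (Fin D)} {y : A → Fin M × Bool} {i j : A}
    (hij : i ≠ j) (hi : a i = none) (hj : a j = none) (hy : (y i).1 = (y j).1) {u : Fin D}
    (hu : ∀ l, a l ≠ some u) :
    heavyWeight a y = 4 * M * heavyWeight (updatePair a i j (some u)) y := by
  rw [heavyWeight, heavyWeight, sum_eq_mul_sum_ite u (y i).1, mul_comm (4 : ℝ), mul_assoc,
    Finset.mul_sum Finset.univ _ (4 : ℝ)]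
  · congr 1
    refine Finset.sum_congr rfl fun h _ => ?_
    have := prod_updatePair (fun l b => heavyKernel h b (y l)) a hij (some u)
    simp only [hi, hj, heavyKernel_none, heavyKernel_some, mul_one] at this
    rw [this, ← hy]
    split_ifs
    · ring
    · simp
  · intro h b
    refine Finset.prod_congr rfl fun l _ => ?_
    cases hl : a l with
    | none => rfl
    | some g =>
      have : g ≠ u := fun hg => hu l (by rw [hl, hg])
      simp [heavyKernel, this]

/-- Passing from `c` to `c'` costs at most a factor `8` per sample, and each of the two removed
light factors is at most `1 / M`. -/
lemma lightWeight_le_updatePair (c c' : A → Bool) {a : A → Option (Fin D)}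
    (y : A → Fin M × Bool) {i j : A} (hij : i ≠ j) (hi : a i = none) (hj : a j = none)
    (hM : 0 < M) (u : Fin D) :
    lightWeight c a y ≤ 8 ^ Fintype.card A / (M : ℝ) ^ 2 *
      lightWeight c' (updatePair a i j (some u)) y := by
  have hMR : (0 : ℝ) < M := by exact_mod_cast hM
  rw [lightWeight, lightWeight, Finset.mul_sum]
  refine Finset.sum_le_sum fun z _ => ?_
  have h1 : ∏ l, lightKernel z (c l) (a l) (y l) ≤
      8 ^ Fintype.card A * ∏ l, lightKernel z (c' l) (a l) (y l) := by
    rw [← Finset.card_univ, ← Finset.prod_const, ← Finset.prod_mul_distrib]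
    refine Finset.prod_le_prod (fun l _ => lightKernel_nonneg _ _ _ _) fun l _ => ?_
    cases a l with
    | none =>
      simp only [lightKernel]
      rw [← mul_div_assoc]
      exact div_le_div_of_nonneg_right (lightMass_le _ _) hMR.le
    | some g => simp [lightKernel]
  refine h1.trans ?_
  rw [div_mul_eq_mul_div, mul_div_assoc]
  refine mul_le_mul_of_nonneg_left ?_ (by positivity)
  have h2 := prod_updatePair (fun l b => lightKernel z (c' l) b (y l)) a hij (some u)
  simp only [hi, hj, lightKernel_none, lightKernel_some, mul_one] at h2
  rw [← h2, div_mul_div_comm, ← pow_two, ← mul_div_assoc]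
  refine div_le_div_of_nonneg_right (mul_le_of_le_one_right
    (Finset.prod_nonneg fun l _ => lightKernel_nonneg _ _ _ _) ?_) (by positivity)
  exact mul_le_one₀ (lightMass_le_one _) (lightMass_pos _).le (lightMass_le_one _)

/-- The contribution of a latent configuration with two light samples in the same pair is dominated
by that of a configuration in which these two samples are heavy. -/
lemma latent_term_le {ε : ℝ} {w : Fin D → ℝ} (h0 : 0 ≤ ε) (h1 : ε ≤ 2 / 3)
    (hw : ∀ g : Fin D, (1 / 2 : ℝ) ^ ((g : ℕ) + 1) ≤ w g) (c c' : A → Bool)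
    {a : A → Option (Fin D)} {y : A → Fin M × Bool} {i j : A} (hij : i ≠ j) (hi : a i = none)
    (hj : a j = none) (hy : (y i).1 = (y j).1) (hM : 0 < M) {u : Fin D}
    (huk : (u : ℕ) < Fintype.card A) (hu : ∀ l, a l ≠ some u) :
    (∏ l, latentMass ε w (a l)) * (heavyWeight a y * lightWeight c a y) ≤
      36 * 32 ^ Fintype.card A * (ε ^ 2 / M) *
        ((∏ l, latentMass ε w (updatePair a i j (some u) l)) *
          (heavyWeight (updatePair a i j (some u)) y *
            lightWeight c' (updatePair a i j (some u)) y)) := by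
  have hMR : (0 : ℝ) < M := by exact_mod_cast hM
  set a' := updatePair a i j (some u)
  set k := Fintype.card A
  have hwpos : ∀ g, 0 ≤ w g := fun g => le_trans (by positivity) (hw g)
  have hΩ' : 0 ≤ ∏ l, latentMass ε w (a' l) :=
    Finset.prod_nonneg fun l _ => latentMass_nonneg h0 (by linarith) hwpos _
  have hH' := heavyWeight_nonneg a' y
  have hL' := lightWeight_nonneg c' a' y
  have hΩeq := prod_updatePair (fun _ b => latentMass ε w b) a hij (some u)
  simp only [hi, hj, latentMass_none, latentMass_some] at hΩeq
  -- As `u < k`, the geometric weight of `u` is at least `2⁻ᵏ`, whatever `D` is; and `1 - ε ≥ 1/3`.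
  have hwu : (1 / 3) * (1 / 2 : ℝ) ^ k ≤ (1 - ε) * w u := by
    have : (1 / 2 : ℝ) ^ k ≤ w u :=
      (pow_le_pow_of_le_one (by norm_num) (by norm_num) huk).trans (hw u)
    exact mul_le_mul (by linarith) this (by positivity) (by linarith)
  have hΩ : ∏ l, latentMass ε w (a l) ≤ 9 * 4 ^ k * ε ^ 2 * ∏ l, latentMass ε w (a' l) := by
    have hsq : (1 / 3 * (1 / 2 : ℝ) ^ k) * (1 / 3 * (1 / 2 : ℝ) ^ k) ≤
        (1 - ε) * w u * ((1 - ε) * w u) :=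
      mul_le_mul hwu hwu (by positivity) (le_trans (by positivity) hwu)
    have hone : (9 * 4 ^ k : ℝ) * ((1 / 3 * (1 / 2 : ℝ) ^ k) * (1 / 3 * (1 / 2 : ℝ) ^ k)) = 1 := by
      have : (4 : ℝ) ^ k * ((1 / 2 : ℝ) ^ k * (1 / 2 : ℝ) ^ k) = 1 := by
        rw [← mul_pow, ← mul_pow]; norm_num
      linear_combination this
    have hΩ0 : 0 ≤ ∏ l, latentMass ε w (a l) :=
      Finset.prod_nonneg fun l _ => latentMass_nonneg h0 (by linarith) hwpos _
    calc ∏ l, latentMass ε w (a l)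
        = 9 * 4 ^ k * ((∏ l, latentMass ε w (a l)) *
          ((1 / 3 * (1 / 2 : ℝ) ^ k) * (1 / 3 * (1 / 2 : ℝ) ^ k))) := by
          linear_combination (-∏ l, latentMass ε w (a l)) * hone
      _ ≤ 9 * 4 ^ k * ((∏ l, latentMass ε w (a l)) * ((1 - ε) * w u * ((1 - ε) * w u))) := by
          gcongr
      _ = _ := by rw [← hΩeq]; ring
  have hH := heavyWeight_eq_updatePair hij hi hj hy hu
  have hL := lightWeight_le_updatePair c c' y hij hi hj hM u
  -- The powers of `M` combine to `M / M² = 1 / M`; the constants are `36 = 9 · 4` and `32 = 4 · 8`.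
  calc (∏ l, latentMass ε w (a l)) * (heavyWeight a y * lightWeight c a y)
      ≤ (9 * 4 ^ k * ε ^ 2 * ∏ l, latentMass ε w (a' l)) *
        (4 * M * heavyWeight a' y * (8 ^ k / (M : ℝ) ^ 2 * lightWeight c' a' y)) := by
        rw [hH]
        refine mul_le_mul hΩ (mul_le_mul_of_nonneg_left hL (by positivity)) ?_ (by positivity)
        exact mul_nonneg (by positivity) (lightWeight_nonneg _ _ _)
    _ = _ := by
        rw [show (32 : ℝ) ^ k = 4 ^ k * 8 ^ k by rw [← mul_pow]; norm_num]
        field_simp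
        ring

/-- Reversing orientations changes the law of `k` samples from a random block by a relative amount
of order `ε² / M`, and only if `k ≥ 2`. -/
lemma abs_blockLaw_sub_le {ε : ℝ} {w : Fin D → ℝ} (h0 : 0 ≤ ε) (h1 : ε ≤ 2 / 3)
    (hw : ∀ g : Fin D, (1 / 2 : ℝ) ^ ((g : ℕ) + 1) ≤ w g) (c c' : A → Bool)
    (y : A → Fin M × Bool) (hM : 0 < M) (hD : Fintype.card A ≤ D) :
    |blockLaw ε w c y - blockLaw ε w c' y| ≤
      36 * 32 ^ Fintype.card A * (Finset.univ : Finset A).offDiag.card * (ε ^ 2 / M) *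
        blockLaw ε w c' y := by
  have hwpos : ∀ g, 0 ≤ w g := fun g => le_trans (by positivity) (hw g)
  rw [blockLaw_eq, blockLaw_eq, ← mul_sub, abs_mul, abs_of_nonneg (by positivity :
    (0 : ℝ) ≤ (Fintype.card ((Fin D → Fin M) × (Fin M → Bool)) : ℝ)⁻¹), mul_left_comm]
  refine mul_le_mul_of_nonneg_left ?_ (by positivity)
  set K : ℝ := 36 * 32 ^ Fintype.card A * (ε ^ 2 / M) with hK
  have hK0 : 0 ≤ K := by positivity
  let t : (A → Bool) → (A → Option (Fin D)) → ℝ := fun c a =>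
    (∏ i, latentMass ε w (a i)) * (heavyWeight a y * lightWeight c a y)
  have ht0 : ∀ c a, 0 ≤ t c a := fun c a => mul_nonneg
    (Finset.prod_nonneg fun l _ => latentMass_nonneg h0 (by linarith) hwpos _)
    (mul_nonneg (heavyWeight_nonneg _ _) (lightWeight_nonneg _ _ _))
  -- The default `none` occurs only for configurations without light samples, which the indicators
  -- below exclude.
  have hu : ∀ a : A → Option (Fin D), ∃ u : Option (Fin D), (∃ i, a i = none) →
      ∃ v, u = some v ∧ (v : ℕ) < Fintype.card A ∧ ∀ l, a l ≠ some v := by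
    intro a
    by_cases h : ∃ i, a i = none
    · obtain ⟨i, hi⟩ := h
      obtain ⟨v, hv⟩ := exists_unused_index a hD hi
      exact ⟨some v, fun _ => ⟨v, rfl, hv⟩⟩
    · exact ⟨none, fun h' => absurd h' h⟩
  choose u hu using hu
  have hterm : ∀ a, |t c a - t c' a| ≤ ∑ P ∈ (Finset.univ : Finset A).offDiag,
      if a P.1 = none ∧ a P.2 = none then K * t c' (updatePair a P.1 P.2 (u a)) else 0 := by
    intro a
    by_cases hinj : ∀ i j, a i = none → a j = none → (y i).1 = (y j).1 → i = j
    · simp only [t]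
      rw [lightWeight_eq_of_injOn c c' a y hinj, sub_self, abs_zero]
      refine Finset.sum_nonneg fun P _ => ?_
      split_ifs
      · exact mul_nonneg hK0 (ht0 _ _)
      · exact le_rfl
    · push Not at hinj
      obtain ⟨i, j, hi, hj, hy, hij⟩ := hinj
      obtain ⟨v, huv, hvk, hv⟩ := hu a ⟨i, hi⟩
      have hmem : (i, j) ∈ (Finset.univ : Finset A).offDiag := by simp [hij]
      refine le_trans ?_ (Finset.single_le_sum (f := fun P : A × A =>
        if a P.1 = none ∧ a P.2 = none then K * t c' (updatePair a P.1 P.2 (u a)) else 0)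
        (fun P _ => ?_) hmem)
      · simp only [hi, hj, and_self, if_true]
        rw [huv]
        -- Both terms are nonnegative with the same upper bound, so their difference obeys it too.
        have hb1 := latent_term_le h0 h1 hw c c' hij hi hj hy hM hvk hv
        have hb2 := latent_term_le h0 h1 hw c' c' hij hi hj hy hM hvk hv
        have p1 := ht0 c a
        have p2 := ht0 c' a
        simp only [t] at p1 p2 ⊢
        rw [abs_le]
        constructor <;> linarith
      · split_ifs
        · exact mul_nonneg hK0 (ht0 _ _)
        · exact le_rfl
  -- For a fixed pair the replacement is injective: the overwritten values were both `none`. Hence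
  -- no target configuration is charged twice.
  have hinj : ∀ P ∈ (Finset.univ : Finset A).offDiag,
      ∑ a : A → Option (Fin D), (if a P.1 = none ∧ a P.2 = none then
        K * t c' (updatePair a P.1 P.2 (u a)) else 0) ≤ K * ∑ a, t c' a := by
    intro P hP
    rw [← Finset.sum_filter, ← Finset.mul_sum]
    refine mul_le_mul_of_nonneg_left ?_ hK0
    rw [← Finset.sum_image (f := t c') (g := fun a => updatePair a P.1 P.2 (u a))]
    · exact Finset.sum_le_sum_of_subset_of_nonneg (Finset.subset_univ _) fun a _ _ => ht0 _ _
    · intro a ha b hb hab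
      simp only [Finset.coe_filter, Finset.mem_univ, true_and, Set.mem_ofPred_eq] at ha hb
      funext l
      have := congrFun hab l
      simp only [updatePair] at this
      by_cases hl1 : l = P.1
      · rw [hl1, ha.1, hb.1]
      · by_cases hl2 : l = P.2
        · rw [hl2, ha.2, hb.2]
        · simpa [hl1, hl2] using this
  calc |∑ a, t c a - ∑ a, t c' a| ≤ ∑ a, |t c a - t c' a| := by
        rw [← Finset.sum_sub_distrib]
        exact Finset.abs_sum_le_sum_abs _ _
    _ ≤ ∑ a, ∑ P ∈ (Finset.univ : Finset A).offDiag,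
        if a P.1 = none ∧ a P.2 = none then K * t c' (updatePair a P.1 P.2 (u a)) else 0 :=
        Finset.sum_le_sum fun a _ => hterm a
    _ ≤ ∑ P ∈ (Finset.univ : Finset A).offDiag, K * ∑ a, t c' a := by
        rw [Finset.sum_comm]
        exact Finset.sum_le_sum hinj
    _ = _ := by
        rw [Finset.sum_const, nsmul_eq_mul, hK]
        ring

end

/-- Normalizing the truncated geometric weights only increases them. -/
lemma exists_geometric_weights {D : ℕ} (hD : 0 < D) :
    ∃ w : Fin D → ℝ, ∑ g, w g = 1 ∧ ∀ g : Fin D, (1 / 2 : ℝ) ^ ((g : ℕ) + 1) ≤ w g := by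
  have hsum : ∀ n : ℕ, ∑ g ∈ Finset.range n, (1 / 2 : ℝ) ^ (g + 1) = 1 - (1 / 2) ^ n := by
    intro n
    induction n with
    | zero => simp
    | succ n ih => rw [Finset.sum_range_succ, ih]; ring
  have hlt : (1 / 2 : ℝ) ^ D < 1 := pow_lt_one₀ (by norm_num) (by norm_num) hD.ne'
  have hpos : (0 : ℝ) < (1 / 2) ^ D := by positivity
  refine ⟨fun g => (1 / 2) ^ ((g : ℕ) + 1) / (1 - (1 / 2) ^ D), ?_, fun g => ?_⟩
  · rw [← Finset.sum_div, Fin.sum_univ_eq_sum_range (fun g => (1 / 2 : ℝ) ^ (g + 1)), hsum,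
      div_self (by linarith)]
  · rw [le_div_iff₀ (by linarith)]
    exact mul_le_of_le_one_right (by positivity) (by linarith)

/-! ### Normalization and orientation statistic of a block -/

section

variable {D M : ℕ}

/-- Expansion of the sum of a function against the mass function of a block. -/
lemma sum_blockMass_mul (ε : ℝ) (w : Fin D → ℝ) (θ : (Fin D → Fin M) × (Fin M → Bool)) (σ : Bool)
    (φ : Fin M × Bool → ℝ) :
    ∑ y, blockMass ε w θ σ y * φ y =
      ε * ∑ v, (∑ b, lightMass (b ^^ (θ.2 v ^^ σ)) * φ (v, b)) / M +
        (1 - ε) * ∑ g, w g * ((∑ b, φ (θ.1 g, b)) / 2) := by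
  simp only [blockMass, Finset.sum_mul]
  rw [Finset.sum_comm, Fintype.sum_option]
  congr 1
  · simp only [latentMass_none, heavyKernel_none, lightKernel_none, one_mul, Fintype.sum_prod_type,
      Finset.mul_sum, Finset.sum_div]
    exact Finset.sum_congr rfl fun v _ => Finset.sum_congr rfl fun b _ => by ring
  · rw [Finset.mul_sum]
    refine Finset.sum_congr rfl fun g _ => ?_
    simp only [latentMass_some, heavyKernel_some, lightKernel_some, mul_one, Fintype.sum_prod_type]
    rw [Finset.sum_eq_single (θ.1 g)]
    · simp only [if_true, Fintype.sum_bool]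
      ring
    · intro v _ hv
      simp [hv]
    · simp

lemma sum_blockMass (ε : ℝ) {w : Fin D → ℝ} (hw : ∑ g, w g = 1) (hM : 0 < M)
    (θ : (Fin D → Fin M) × (Fin M → Bool)) (σ : Bool) : ∑ y, blockMass ε w θ σ y = 1 := by
  have hMR : (0 : ℝ) < M := by exact_mod_cast hM
  have h := sum_blockMass_mul ε w θ σ fun _ => 1
  have hl : ∀ t : Bool, ∑ b, lightMass (b ^^ t) * 1 = 1 := by
    intro t
    cases t <;> norm_num [lightMass]
  simp only [mul_one] at h hl
  simp only [hl, Finset.sum_const, Finset.card_univ, Fintype.card_fin, Fintype.card_bool,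
    nsmul_eq_mul, mul_one] at h
  rw [h]
  norm_num [hw, hMR.ne']

/-- Heavy pairs are symmetric and cancel; a light pair contributes `±(7/8 - 1/8)`. -/
lemma sum_blockMass_mul_orientation (ε : ℝ) (w : Fin D → ℝ) (hM : 0 < M)
    (θ : (Fin D → Fin M) × (Fin M → Bool)) (σ : Bool) :
    ∑ y, blockMass ε w θ σ y * -boolSign (y.2 ^^ θ.2 y.1) = ε * (-boolSign σ * (3 / 4)) := by
  have hMR : (0 : ℝ) < M := by exact_mod_cast hM
  rw [sum_blockMass_mul]
  have hl : ∀ v, ∑ b, lightMass (b ^^ (θ.2 v ^^ σ)) * -boolSign (b ^^ θ.2 v) =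
      -boolSign σ * (3 / 4) := by
    intro v
    cases θ.2 v <;> cases σ <;> norm_num [lightMass, boolSign]
  have hh : ∀ v, ∑ b, -boolSign (b ^^ θ.2 v) = 0 := by
    intro v
    cases θ.2 v <;> norm_num [boolSign]
  simp only [hl, hh]
  simp only [Finset.sum_const, Finset.card_univ, Fintype.card_fin, nsmul_eq_mul, zero_div,
    mul_zero, add_zero]
  field_simp

lemma blockLaw_nonneg {A : Type*} [Fintype A] {ε : ℝ} {w : Fin D → ℝ} (h0 : 0 ≤ ε) (h1 : ε ≤ 1)
    (hw : ∀ g, 0 ≤ w g) (c : A → Bool) (y : A → Fin M × Bool) : 0 ≤ blockLaw ε w c y :=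
  mul_nonneg (by positivity) (Finset.sum_nonneg fun _ _ => Finset.prod_nonneg fun _ _ =>
    blockMass_nonneg h0 h1 hw _ _ _)

lemma sum_blockLaw {A : Type*} [Fintype A] [DecidableEq A] (ε : ℝ) {w : Fin D → ℝ}
    (hw : ∑ g, w g = 1) (hM : 0 < M) (c : A → Bool) :
    ∑ y : A → Fin M × Bool, blockLaw ε w c y = 1 := by
  have : NeZero M := ⟨hM.ne'⟩
  simp only [blockLaw]
  rw [← Finset.mul_sum, Finset.sum_comm]
  have : ∀ θ : (Fin D → Fin M) × (Fin M → Bool),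
      ∑ y : A → Fin M × Bool, ∏ i, blockMass ε w θ (c i) (y i) = 1 := by
    intro θ
    rw [sum_pi_prod fun i y => blockMass ε w θ (c i) y]
    simp [sum_blockMass ε hw hM]
  simp only [this, Finset.sum_const, Finset.card_univ, nsmul_eq_mul, mul_one]
  exact inv_mul_cancel₀ (by exact_mod_cast Fintype.card_ne_zero)

end

/-! ### Many blocks: products and occupancy numbers -/

/-- Product measures whose factors have relative density close to one are close in `ℓ₁`. -/
lemma sq_sum_abs_prod_sub_prod_le {κ : Type*} [Fintype κ] [DecidableEq κ] {Ω : κ → Type*}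
    [∀ j, Fintype (Ω j)] (P Q : ∀ j, Ω j → ℝ) (δ : κ → ℝ) (hP0 : ∀ j x, 0 ≤ P j x)
    (hQ0 : ∀ j x, 0 ≤ Q j x) (hP : ∀ j, ∑ x, P j x = 1) (hQ : ∀ j, ∑ x, Q j x = 1)
    (hPQ : ∀ j x, |P j x - Q j x| ≤ δ j * Q j x) :
    (∑ x : ∀ j, Ω j, |∏ j, P j (x j) - ∏ j, Q j (x j)|) ^ 2 ≤ 8 * ∑ j, δ j ^ 2 := by
  have hPs : ∑ x : ∀ j, Ω j, ∏ j, P j (x j) = 1 := by rw [sum_pi_prod P]; simp [hP]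
  have hQs : ∑ x : ∀ j, Ω j, ∏ j, Q j (x j) = 1 := by rw [sum_pi_prod Q]; simp [hQ]
  have hzero : ∀ j x, Q j x = 0 → P j x = 0 := by
    intro j x h
    have := hPQ j x
    rw [h, mul_zero, sub_zero] at this
    exact abs_nonpos_iff.1 this
  have hfactor : ∀ j, ∑ x, P j x ^ 2 / Q j x ≤ Real.exp (δ j ^ 2) := by
    intro j
    -- This is `P² / Q = 2P - Q + (P - Q)² / Q` with the hypothesis on the relative density.
    have hle : ∀ x, P j x ^ 2 / Q j x ≤ 2 * P j x - Q j x + δ j ^ 2 * Q j x := by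
      intro x
      rcases eq_or_ne (Q j x) 0 with h | h
      · simp [h, hzero j x h]
      · have hpos := lt_of_le_of_ne (hQ0 j x) h.symm
        rw [div_le_iff₀ hpos]
        have hsq := pow_le_pow_left₀ (abs_nonneg _) (hPQ j x) 2
        rw [sq_abs] at hsq
        nlinarith
    calc ∑ x, P j x ^ 2 / Q j x ≤ ∑ x, (2 * P j x - Q j x + δ j ^ 2 * Q j x) :=
          Finset.sum_le_sum fun x _ => hle x
      _ = δ j ^ 2 + 1 := by
          rw [Finset.sum_add_distrib, Finset.sum_sub_distrib, ← Finset.mul_sum, ← Finset.mul_sum,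
            hP, hQ]
          ring
      _ ≤ _ := Real.add_one_le_exp _
  have hchi := sq_sum_abs_sub_le (fun x : ∀ j, Ω j => ∏ j, P j (x j))
    (fun x => ∏ j, Q j (x j)) hPs hQs (fun x => Finset.prod_nonneg fun j _ => hQ0 j _)
    (fun x h => by
      obtain ⟨j, hj, hj0⟩ := Finset.prod_eq_zero_iff.1 h
      exact Finset.prod_eq_zero hj (hzero j _ hj0))
  have hprod : ∑ x : ∀ j, Ω j, (∏ j, P j (x j)) ^ 2 / ∏ j, Q j (x j) ≤
      Real.exp (∑ j, δ j ^ 2) := by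
    simp only [← Finset.prod_pow, ← Finset.prod_div_distrib]
    rw [sum_pi_prod fun j x => P j x ^ 2 / Q j x, Real.exp_sum]
    exact Finset.prod_le_prod
      (fun j _ => Finset.sum_nonneg fun x _ => div_nonneg (sq_nonneg _) (hQ0 j x))
      fun j _ => hfactor j
  set S := ∑ j, δ j ^ 2
  have hS0 : 0 ≤ S := Finset.sum_nonneg fun j _ => sq_nonneg _
  -- For small `S`, `exp S - 1 ≤ 2S`; for large `S` the trivial bound `2` on the `ℓ₁`-distance
  -- suffices, as `4 ≤ 8S`.
  rcases le_total S (1 / 2) with hS | hS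
  · have hexp := Real.exp_bound_div_one_sub_of_interval hS0 (by linarith)
    have : 1 / (1 - S) ≤ 1 + 2 * S := by
      rw [div_le_iff₀ (by linarith)]
      nlinarith
    linarith
  · have h2 : ∑ x : ∀ j, Ω j, |∏ j, P j (x j) - ∏ j, Q j (x j)| ≤ 2 := by
      calc _ ≤ ∑ x : ∀ j, Ω j, (∏ j, P j (x j) + ∏ j, Q j (x j)) := by
            refine Finset.sum_le_sum fun x _ => ?_
            have p1 : 0 ≤ ∏ j, P j (x j) := Finset.prod_nonneg fun j _ => hP0 j _
            have p2 : 0 ≤ ∏ j, Q j (x j) := Finset.prod_nonneg fun j _ => hQ0 j _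
            rw [abs_le]
            constructor <;> linarith
        _ = 2 := by rw [Finset.sum_add_distrib, hPs, hQs]; norm_num
    have h3 := pow_le_pow_left₀ (Finset.sum_nonneg fun x _ => abs_nonneg _) h2 2
    linarith

section

variable {ι : Type*} [Fintype ι]

/-- Functions on `ι` are families of functions on the fibres of `J`. -/
def fiberEquiv {m : ℕ} (J : ι → Fin m) (W : Type*) :
    (ι → W) ≃ ∀ j, {i // J i = j} → W where
  toFun Y j i := Y i.1
  invFun y i := y (J i) ⟨i, rfl⟩
  left_inv _ := rfl
  right_inv y := by
    funext j ⟨i, hi⟩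
    subst hi
    rfl

/-- The number of ordered pairs of distinct points of a fibre. -/
lemma card_offDiag_fiber {m : ℕ} (J : ι → Fin m) (j : Fin m) :
    ((Finset.univ : Finset {i // J i = j}).offDiag.card : ℝ) =
      ∑ P ∈ (Finset.univ : Finset ι).offDiag, if J P.1 = j ∧ J P.2 = j then 1 else 0 := by
  rw [← Finset.sum_filter, Finset.sum_const, nsmul_eq_mul, mul_one]
  have : (Finset.univ : Finset ι).offDiag.filter (fun P => J P.1 = j ∧ J P.2 = j) =
      (Finset.univ.filter fun i => J i = j).offDiag := by
    ext P
    simp only [Finset.mem_filter, Finset.mem_offDiag, Finset.mem_univ, true_and]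
    tauto
  rw [this, Finset.offDiag_card, Finset.offDiag_card, Finset.card_univ, Fintype.card_subtype]

/-- A weighted second factorial moment of the occupancy of a bin when the points of `ι` are thrown
into `m` bins. -/
lemma sum_offDiag_mul_pow_le [DecidableEq ι] {m : ℕ} (hm : 0 < m) {B : ℝ} (hB : 0 ≤ B) (j : Fin m) :
    ∑ J : ι → Fin m, ((Finset.univ : Finset {i // J i = j}).offDiag.card : ℝ) *
        B ^ Fintype.card {i // J i = j} ≤
      (Fintype.card ι : ℝ) ^ 2 *
        ((m * Real.exp (B / m)) ^ Fintype.card ι * (B / m) ^ 2) := by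
  have hmR : (0 : ℝ) < m := by exact_mod_cast hm
  -- The product of these factors is `B` to the occupancy of `j` when both points of `P` land in
  -- `j`, and the factor `0` kills every other configuration. The sum over `J` thus factorizes.
  let φ : ι × ι → ι → Fin m → ℝ := fun P i v =>
    if v = j then B else if i = P.1 ∨ i = P.2 then 0 else 1
  have hφ0 : ∀ P i v, 0 ≤ φ P i v := by
    intro P i v
    simp only [φ]
    split_ifs <;> first | exact hB | norm_num
  have hpow : ∀ J : ι → Fin m, B ^ Fintype.card {i // J i = j} =
      ∏ i, if J i = j then B else 1 := by
    intro J
    rw [← Finset.prod_filter, Finset.prod_const, Fintype.card_subtype]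
  have hterm : ∀ J : ι → Fin m, ((Finset.univ : Finset {i // J i = j}).offDiag.card : ℝ) *
        B ^ Fintype.card {i // J i = j} ≤
      ∑ P ∈ (Finset.univ : Finset ι).offDiag, ∏ i, φ P i (J i) := by
    intro J
    rw [card_offDiag_fiber, Finset.sum_mul, hpow]
    refine Finset.sum_le_sum fun P _ => ?_
    split_ifs with h
    · rw [one_mul]
      refine le_of_eq (Finset.prod_congr rfl fun i _ => ?_)
      simp only [φ]
      by_cases hi : J i = j
      · simp [hi]
      · have : ¬(i = P.1 ∨ i = P.2) := by
          rintro (rfl | rfl)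
          · exact hi h.1
          · exact hi h.2
        simp [hi, this]
    · rw [zero_mul]
      exact Finset.prod_nonneg fun i _ => hφ0 _ _ _
  have hcoord : ∀ P i, ∑ v, φ P i v ≤
      m * Real.exp (B / m) * if i = P.1 ∨ i = P.2 then B / m else 1 := by
    intro P i
    have hexp : B / m + 1 ≤ Real.exp (B / m) := Real.add_one_le_exp _
    have hdiv : 0 ≤ B / m := by positivity
    by_cases hi : i = P.1 ∨ i = P.2
    · simp only [φ, hi, if_true, Finset.sum_ite_eq', Finset.mem_univ]
      calc B = m * 1 * (B / m) := by field_simp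
        _ ≤ _ := by gcongr; linarith
    · simp only [φ, hi, if_false, mul_one]
      calc ∑ v : Fin m, (if v = j then B else 1) ≤ ∑ v : Fin m, ((if v = j then B else 0) + 1) := by
            refine Finset.sum_le_sum fun v _ => ?_
            split_ifs <;> linarith
        _ = m * (B / m + 1) := by
            rw [Finset.sum_add_distrib]
            simp
            field_simp
        _ ≤ _ := by gcongr
  have hprod : ∀ P ∈ (Finset.univ : Finset ι).offDiag, ∑ J : ι → Fin m, ∏ i, φ P i (J i) ≤
      (m * Real.exp (B / m)) ^ Fintype.card ι * (B / m) ^ 2 := by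
    intro P hP
    rw [sum_pi_prod fun i v => φ P i v]
    refine (Finset.prod_le_prod (fun i _ => Finset.sum_nonneg fun v _ => hφ0 _ _ _)
      fun i _ => hcoord P i).trans (le_of_eq ?_)
    rw [Finset.prod_mul_distrib, Finset.prod_const, Finset.card_univ, ← Finset.prod_filter,
      Finset.prod_const]
    congr 2
    have : Finset.univ.filter (fun i => i = P.1 ∨ i = P.2) = {P.1, P.2} := by
      ext i
      simp
    rw [this, Finset.card_pair (Finset.mem_offDiag.1 hP).2.2]
  calc _ ≤ ∑ J : ι → Fin m, ∑ P ∈ (Finset.univ : Finset ι).offDiag, ∏ i, φ P i (J i) :=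
        Finset.sum_le_sum fun J _ => hterm J
    _ ≤ ∑ P ∈ (Finset.univ : Finset ι).offDiag,
        (m * Real.exp (B / m)) ^ Fintype.card ι * (B / m) ^ 2 := by
        rw [Finset.sum_comm]
        exact Finset.sum_le_sum hprod
    _ ≤ _ := by
        rw [Finset.sum_const, nsmul_eq_mul]
        refine mul_le_mul_of_nonneg_right ?_ (by positivity)
        rw [Finset.offDiag_card, Finset.card_univ, pow_two]
        exact_mod_cast Nat.sub_le _ _

variable {D M m : ℕ}

/-- The law of samples from an instance made of `m` independent random blocks of equal mass. -/
noncomputable def instanceLaw (ε : ℝ) (w : Fin D → ℝ) (c : ι → Bool)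
    (X : ι → Fin m × (Fin M × Bool)) : ℝ :=
  (Fintype.card (Fin m → (Fin D → Fin M) × (Fin M → Bool)) : ℝ)⁻¹ *
    ∑ θ : Fin m → (Fin D → Fin M) × (Fin M → Bool),
      ∏ i, (1 / m * blockMass ε w (θ (X i).1) (c i) (X i).2)

/-- Given the blocks of the samples, different blocks are independent. -/
lemma instanceLaw_eq (ε : ℝ) (w : Fin D → ℝ) (c : ι → Bool) (J : ι → Fin m)
    (Y : ι → Fin M × Bool) :
    instanceLaw ε w c (fun i => (J i, Y i)) = ((1 / m : ℝ) ^ Fintype.card ι) *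
      ∏ j, blockLaw ε w (fun i : {i // J i = j} => c i) (fiberEquiv J _ Y j) := by
  simp only [instanceLaw, blockLaw, Finset.prod_mul_distrib, Finset.prod_const, Finset.card_univ,
    ← Finset.mul_sum]
  rw [mul_left_comm]
  congr 1
  rw [← sum_pi_prod fun j (θ : (Fin D → Fin M) × (Fin M → Bool)) =>
    ∏ i : {i // J i = j}, blockMass ε w θ (c i) (fiberEquiv J _ Y j i)]
  congr 1
  · rw [Fintype.card_pi, Finset.prod_const, Finset.card_univ]
    push_cast
    rw [inv_pow]
  · refine Finset.sum_congr rfl fun θ _ => ?_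
    rw [← Fintype.prod_fiberwise J]
    refine Finset.prod_congr rfl fun j _ => Finset.prod_congr rfl fun i _ => ?_
    simp only [fiberEquiv, Equiv.coe_fn_mk, i.2]

/-- Reversing orientations changes the law of `m` samples from `m` random blocks by little. -/
lemma sq_sum_abs_instanceLaw_sub_le [DecidableEq ι] {ε : ℝ} {w : Fin D → ℝ} (h0 : 0 ≤ ε) (h1 : ε ≤ 2 / 3)
    (hw1 : ∑ g, w g = 1) (hw : ∀ g : Fin D, (1 / 2 : ℝ) ^ ((g : ℕ) + 1) ≤ w g) (c c' : ι → Bool)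
    (hM : 0 < M) (hm : 0 < m) (hιm : Fintype.card ι = m) (hιD : Fintype.card ι ≤ D) :
    (∑ X : ι → Fin m × (Fin M × Bool), |instanceLaw ε w c X - instanceLaw ε w c' X|) ^ 2 ≤
      8 * (36 ^ 2 * 4096 ^ 2 * Real.exp 4096) * (ε ^ 4 * m / (M : ℝ) ^ 2) := by
  have hmR : (0 : ℝ) < m := by exact_mod_cast hm
  have hMR : (0 : ℝ) < M := by exact_mod_cast hM
  have hw0 : ∀ g, 0 ≤ w g := fun g => le_trans (by positivity) (hw g)
  set N := Fintype.card ι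
  let t : (ι → Fin m) → ℝ := fun J => ∑ Y : ι → Fin M × Bool,
    |∏ j, blockLaw ε w (fun i : {i // J i = j} => c i) (fiberEquiv J _ Y j) -
      ∏ j, blockLaw ε w (fun i : {i // J i = j} => c' i) (fiberEquiv J _ Y j)|
  have hsum : ∑ X : ι → Fin m × (Fin M × Bool), |instanceLaw ε w c X - instanceLaw ε w c' X| =
      ∑ J : ι → Fin m, (1 / m : ℝ) ^ N * t J := by
    rw [← (Equiv.arrowProdEquivProdArrow ι (fun _ => Fin m) (fun _ => Fin M × Bool)).symm.sum_comp,
      Fintype.sum_prod_type]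
    refine Finset.sum_congr rfl fun J _ => ?_
    rw [Finset.mul_sum]
    refine Finset.sum_congr rfl fun Y _ => ?_
    have he : (Equiv.arrowProdEquivProdArrow ι (fun _ => Fin m) (fun _ => Fin M × Bool)).symm
      (J, Y) = fun i => (J i, Y i) := rfl
    rw [he, instanceLaw_eq, instanceLaw_eq, ← mul_sub, abs_mul, abs_of_nonneg (by positivity)]
  let o : (ι → Fin m) → Fin m → ℝ := fun J j =>
    ((Finset.univ : Finset {i // J i = j}).offDiag.card : ℝ)
  let k : (ι → Fin m) → Fin m → ℕ := fun J j => Fintype.card {i // J i = j}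
  have ht : ∀ J, t J ^ 2 ≤ 8 * ∑ j, (36 * 32 ^ k J j * o J j * (ε ^ 2 / M)) ^ 2 := by
    intro J
    have := sq_sum_abs_prod_sub_prod_le
      (fun j => blockLaw (M := M) ε w (fun i : {i // J i = j} => c i))
      (fun j => blockLaw (M := M) ε w (fun i : {i // J i = j} => c' i))
      (fun j => 36 * 32 ^ k J j * o J j * (ε ^ 2 / M))
      (fun j x => blockLaw_nonneg h0 (by linarith) hw0 _ _)
      (fun j x => blockLaw_nonneg h0 (by linarith) hw0 _ _)
      (fun j => sum_blockLaw ε hw1 hM _) (fun j => sum_blockLaw ε hw1 hM _)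
      (fun j x => abs_blockLaw_sub_le h0 h1 hw _ _ x hM
        ((Fintype.card_subtype_le _).trans hιD))
    rw [← (fiberEquiv J (Fin M × Bool)).sum_comp] at this
    exact this
  -- One factor `o` is kept for the factorial moment; the other is at most `k² ≤ 4ᵏ`, whence `4096 =
  -- 32² · 4`.
  have hδ : ∀ J j, (36 * 32 ^ k J j * o J j * (ε ^ 2 / M)) ^ 2 ≤
      36 ^ 2 * (ε ^ 4 / (M : ℝ) ^ 2) * (o J j * 4096 ^ k J j) := by
    intro J j
    have ho0 : 0 ≤ o J j := Nat.cast_nonneg _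
    have ho : o J j ≤ 4 ^ k J j := by
      have h2 : k J j ≤ 2 ^ k J j := Nat.lt_two_pow_self.le
      have h3 : (Finset.univ : Finset {i // J i = j}).offDiag.card ≤ 4 ^ k J j := by
        rw [Finset.offDiag_card, Finset.card_univ]
        calc _ ≤ k J j * k J j := Nat.sub_le _ _
          _ ≤ 2 ^ k J j * 2 ^ k J j := Nat.mul_le_mul h2 h2
          _ = 4 ^ k J j := by rw [← mul_pow]; norm_num
      have h4 := (Nat.cast_le (α := ℝ)).2 h3
      push_cast at h4
      exact h4
    rw [show (4096 : ℝ) ^ k J j = 32 ^ k J j * 32 ^ k J j * 4 ^ k J j by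
      rw [← mul_pow, ← mul_pow]; norm_num]
    calc (36 * 32 ^ k J j * o J j * (ε ^ 2 / M)) ^ 2 =
        36 ^ 2 * (ε ^ 4 / (M : ℝ) ^ 2) * (o J j * (32 ^ k J j * 32 ^ k J j * o J j)) := by
          field_simp
      _ ≤ _ := by gcongr
  have hmass : ∑ _J : ι → Fin m, (1 / m : ℝ) ^ N = 1 := by
    rw [Finset.sum_const, Finset.card_univ, Fintype.card_pi, Finset.prod_const, Finset.card_univ,
      Fintype.card_fin, nsmul_eq_mul]
    push_cast
    rw [← mul_pow, mul_one_div_cancel hmR.ne', one_pow]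
  -- Jensen's inequality for the square, over the uniform law of the block assignment `J`.
  have hCS := Finset.sum_sq_le_sum_mul_sum_of_sq_le_mul Finset.univ
    (r := fun J : ι → Fin m => (1 / m : ℝ) ^ N * t J) (f := fun _ => (1 / m : ℝ) ^ N)
    (g := fun J => (1 / m : ℝ) ^ N * t J ^ 2) (fun J _ => by positivity)
    (fun J _ => by positivity) (fun J _ => le_of_eq (by ring))
  rw [hmass, one_mul] at hCS
  rw [hsum]
  refine hCS.trans ?_
  -- Having as many blocks as samples turns the exponential factor into an absolute constant.
  have hBm : (m * Real.exp (4096 / m)) ^ N = (m : ℝ) ^ N * Real.exp 4096 := by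
    rw [mul_pow, ← Real.exp_nat_mul, hιm, mul_div_cancel₀ _ hmR.ne']
  calc ∑ J : ι → Fin m, (1 / m : ℝ) ^ N * t J ^ 2
      ≤ ∑ J : ι → Fin m, (1 / m : ℝ) ^ N * (8 * ∑ j,
          36 ^ 2 * (ε ^ 4 / (M : ℝ) ^ 2) * (o J j * 4096 ^ k J j)) := by
        gcongr with J _
        refine (ht J).trans ?_
        gcongr with j _
        exact hδ J j
    _ = (1 / m : ℝ) ^ N * (8 * (36 ^ 2 * (ε ^ 4 / (M : ℝ) ^ 2) *
          ∑ j, ∑ J : ι → Fin m, o J j * 4096 ^ k J j)) := by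
        rw [Finset.sum_comm]
        simp only [Finset.mul_sum]
    _ ≤ (1 / m : ℝ) ^ N * (8 * (36 ^ 2 * (ε ^ 4 / (M : ℝ) ^ 2) *
          ∑ _j : Fin m, (N : ℝ) ^ 2 * ((m * Real.exp (4096 / m)) ^ N * (4096 / m) ^ 2))) := by
        gcongr with j _
        exact sum_offDiag_mul_pow_le hm (by norm_num) j
    _ = _ := by
        rw [Finset.sum_const, Finset.card_univ, Fintype.card_fin, nsmul_eq_mul, hBm, one_div,
          inv_pow, hιm]
        field_simp

end

/-- A tester draws at least one sample. -/
lemma one_le_of_isClosenessTester {n s : ℕ} [NeZero n] (hn : 2 ≤ n) {ε : ℝ} (h1 : ε ≤ 1)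
    {T : Algorithm n} (hT : IsClosenessTester (PMF.uniformOfFintype (Fin n)) ε T)
    (hs : T.DrawsAtMost s) : 1 ≤ s := by
  by_contra hlt
  obtain rfl : s = 0 := by omega
  have hnR : (2 : ℝ) ≤ n := by exact_mod_cast hn
  -- Without samples, uniform `p` and a point mass are indistinguishable, though at distance `2 -
  -- 2/n ≥ 1`.
  have key := one_third_le_of_isClosenessTester hT hs (Θ := Unit) (id : Fin n → Fin n)
    (fun _ => PMF.uniformOfFintype (Fin n)) (fun _ => PMF.uniformOfFintype (Fin n))
    (fun _ => PMF.pure 0) (fun _ => PMF.uniformOfFintype (Fin n))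
    (fun _ => ⟨0, by simp, fun x => by simp⟩) (fun _ ρ hρ => by
      obtain ⟨α, -, hα⟩ := hρ
      have hρ' : ∀ x, (ρ x).toReal = 1 / n := by
        intro x
        rw [hα x, PMF.map_id]
        simp
        ring
      have hφ := sum_mul_sub_le_l1Dist (PMF.map id (PMF.pure (0 : Fin n))) ρ
        (fun x => if x = 0 then 1 else -1) (fun x => by split_ifs <;> simp)
      refine le_trans ?_ hφ
      rw [sum_map_toReal_mul]
      have e1 : ∑ v : Fin n, (PMF.pure (0 : Fin n) v).toReal *
          (fun x : Fin n => if x = 0 then (1 : ℝ) else -1) (id v) = 1 := by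
        rw [Finset.sum_eq_single 0] <;> simp +contextual
      have e2 : ∑ x : Fin n, (ρ x).toReal * (if x = 0 then (1 : ℝ) else -1) = 2 / n - 1 := by
        have : ∀ x : Fin n, (ρ x).toReal * (if x = 0 then (1 : ℝ) else -1) =
            (if x = 0 then 2 / (n : ℝ) else 0) - 1 / n := by
          intro x
          rw [hρ']
          split_ifs <;> ring
        simp only [this, Finset.sum_sub_distrib]
        simp
      rw [e1, e2]
      have : 2 / (n : ℝ) ≤ 1 := by rw [div_le_one (by linarith)]; exact hnR
      linarith)
  simp at key
  norm_num at key

/-! ### Distance of rejected instances from all noisy versions -/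

section

variable {D M m : ℕ} {ε : ℝ} {w : Fin D → ℝ}

/-- The distribution made of `m` blocks of equal mass. -/
noncomputable def instancePMF (h0 : 0 ≤ ε) (h1 : ε ≤ 1) (hw0 : ∀ g, 0 ≤ w g)
    (hw1 : ∑ g, w g = 1) (hM : 0 < M) (hm : 0 < m)
    (θ : Fin m → (Fin D → Fin M) × (Fin M → Bool)) (σ : Bool) : PMF (Fin m × (Fin M × Bool)) :=
  ofRealMass (fun x => 1 / m * blockMass ε w (θ x.1) σ x.2)
    (fun x => mul_nonneg (by positivity) (blockMass_nonneg h0 h1 hw0 _ _ _)) (by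
      rw [Fintype.sum_prod_type]
      simp only [← Finset.mul_sum, sum_blockMass ε hw1 hM]
      have : (m : ℝ) ≠ 0 := by exact_mod_cast hm.ne'
      simp [this])

/-- A mixture of blocks is far from all noisy versions of the mixture with reversed orientations. -/
lemma isFar_instancePMF {n : ℕ} [NeZero n] (h0 : 0 ≤ ε) (h1 : ε ≤ 2 / 3) (hw0 : ∀ g, 0 ≤ w g)
    (hw1 : ∑ g, w g = 1) (hM : 0 < M) (hm : 0 < m) (hn : 4 * (m * M) ≤ n)
    (f : Fin m × (Fin M × Bool) ↪ Fin n) (θ : Fin m → (Fin D → Fin M) × (Fin M → Bool)) :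
    IsFar (3 / 2 * ε) ((instancePMF h0 (by linarith) hw0 hw1 hM hm θ false).map f)
      (mixtures ((instancePMF h0 (by linarith) hw0 hw1 hM hm θ true).map f)
        (PMF.uniformOfFintype (Fin n))) := by
  rintro ρ ⟨α, ⟨hα0, hα1⟩, hα⟩
  have hmR : (0 : ℝ) < m := by exact_mod_cast hm
  have hnR : (0 : ℝ) < n := by exact_mod_cast NeZero.pos n
  let φ₀ : Fin m × (Fin M × Bool) → ℝ := fun x => -boolSign (x.2.2 ^^ (θ x.1).2 x.2.1)
  -- The test function reads the orientation inside the blocks and is `-1` outside, so it has mean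
  -- `3ε/4` under `p`, `-3ε/4` under `q`, and at most `-1/2` under the noise.
  let φ : Fin n → ℝ := Function.extend f φ₀ fun _ => -1
  have hφf : ∀ v, φ (f v) = φ₀ v := fun v => f.injective.extend_apply _ _ v
  have hφo : ∀ x, x ∉ Set.range f → φ x = -1 := fun x hx =>
    Function.extend_apply' _ _ _ fun ⟨v, hv⟩ => hx ⟨v, hv⟩
  have hφ1 : ∀ x, |φ x| ≤ 1 := by
    intro x
    by_cases hx : x ∈ Set.range f
    · obtain ⟨v, rfl⟩ := hx
      rw [hφf, abs_neg, abs_boolSign]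
    · rw [hφo x hx]
      simp
  have hblock : ∀ σ, ∑ x, ((instancePMF h0 (by linarith) hw0 hw1 hM hm θ σ).map f x).toReal *
      φ x = ε * (-boolSign σ * (3 / 4)) := by
    intro σ
    rw [sum_map_toReal_mul]
    simp only [hφf, instancePMF, toReal_ofRealMass, φ₀]
    rw [Fintype.sum_prod_type]
    have : ∀ j, ∑ y : Fin M × Bool, 1 / (m : ℝ) * blockMass ε w (θ j) σ y *
        -boolSign (y.2 ^^ (θ j).2 y.1) = 1 / m * (ε * (-boolSign σ * (3 / 4))) := by
      intro j
      rw [← sum_blockMass_mul_orientation ε w hM (θ j) σ, Finset.mul_sum]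
      simp only [mul_assoc]
    simp only [this, Finset.sum_const, Finset.card_univ, Fintype.card_fin, nsmul_eq_mul]
    field_simp
  have hunif : ∑ x : Fin n, φ x ≤ -(n / 2 : ℝ) := by
    have h2 : ∑ v, (φ₀ v + 1) = ∑ x, (φ x + 1) :=
      Fintype.sum_of_injective f f.injective _ _ (fun x hx => by rw [hφo x hx]; norm_num)
        fun v => by rw [hφf]
    have h3 : ∑ v, φ₀ v = 0 := by
      simp only [φ₀]
      rw [Fintype.sum_prod_type]
      refine Finset.sum_eq_zero fun j _ => ?_
      rw [Fintype.sum_prod_type]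
      refine Finset.sum_eq_zero fun v _ => ?_
      dsimp only
      cases (θ j).2 v <;> simp [boolSign]
    rw [Finset.sum_add_distrib, Finset.sum_add_distrib, h3] at h2
    simp only [Finset.sum_const, Finset.card_univ, Fintype.card_prod, Fintype.card_fin,
      Fintype.card_bool, nsmul_eq_mul, mul_one, zero_add] at h2
    push_cast at h2
    have : 4 * ((m : ℝ) * M) ≤ n := by exact_mod_cast hn
    linarith
  refine le_trans ?_ (sum_mul_sub_le_l1Dist _ ρ φ hφ1)
  have hρ : ∑ x, (ρ x).toReal * φ x = (1 - α) * (ε * (-boolSign true * (3 / 4))) +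
      α * ((1 / n) * ∑ x, φ x) := by
    rw [← hblock true, Finset.mul_sum, Finset.mul_sum, Finset.mul_sum, ← Finset.sum_add_distrib]
    refine Finset.sum_congr rfl fun x _ => ?_
    rw [hα x]
    simp
    ring
  rw [hblock, hρ]
  have hu : 1 / (n : ℝ) * ∑ x, φ x ≤ -(1 / 2) := by
    rw [one_div_mul_eq_div, div_le_iff₀ hnR]
    linarith
  have := mul_le_mul_of_nonneg_left hu hα0
  simp only [boolSign, if_true, Bool.false_eq_true, if_false]
  -- Since `ε ≤ 2/3`, also `-1/2 ≤ -3ε/4`; every mixture therefore has mean at most `-3ε/4`.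
  nlinarith

end

/-! ### Choice of parameters and combination of the two bounds -/

/-- The closeness-testing lower bound. -/
lemma closeness_lower_bound : ∃ C : ℝ, 0 < C ∧ ∀ {n s : ℕ} [NeZero n], 1 ≤ s → 8 * s ≤ n →
    ∀ {ε : ℝ}, 0 < ε → ε ≤ 1 → ∀ {T : Algorithm n},
      IsClosenessTester (PMF.uniformOfFintype (Fin n)) ε T → T.DrawsAtMost s →
        (n : ℝ) ^ 2 ≤ C * ((s : ℝ) ^ 3 * ε ^ 4) := by
  set K : ℝ := 8 * (36 ^ 2 * 4096 ^ 2 * Real.exp 4096)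
  have hK : 0 < K := by positivity
  refine ⟨9 * (512 * K), by positivity, ?_⟩
  intro n s _ hs1 hsn ε h0 h1 T hT hs
  -- Light mass `e` gives distance `3e/2 = ε`, and `e ≤ 2/3` as the distance bound requires.
  set e : ℝ := 2 / 3 * ε with he
  have he0 : 0 ≤ e := by positivity
  have he1 : e ≤ 2 / 3 := by linarith
  -- As many blocks, and heavy pairs per block, as samples in total from `p` and `q`.
  set m := 2 * s with hmdef
  have hm : 0 < m := by omega
  -- The `2mM` points of the blocks fill at most half of the domain; `8s ≤ n` ensures `M ≥ 1`.
  set M := n / (4 * m)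
  have hM : 0 < M := Nat.div_pos (by omega) (by omega)
  have hMn : 4 * (m * M) ≤ n := by
    have := Nat.mul_div_le n (4 * m)
    rwa [mul_assoc] at this
  have hnM : n ≤ 8 * (m * M) := by
    have h2 := Nat.lt_mul_div_succ n (show 0 < 4 * m by omega)
    have h3 : 4 * m * (n / (4 * m) + 1) ≤ 4 * m * (2 * M) := Nat.mul_le_mul_left _ (by omega)
    nlinarith
  obtain ⟨w, hw1, hw⟩ := exists_geometric_weights hm
  have hw0 : ∀ g, 0 ≤ w g := fun g => le_trans (by positivity) (hw g)
  have hcardV : Fintype.card (Fin m × (Fin M × Bool)) ≤ Fintype.card (Fin n) := by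
    simp only [Fintype.card_prod, Fintype.card_fin, Fintype.card_bool]
    nlinarith
  obtain ⟨f⟩ := Function.Embedding.nonempty_of_card_le hcardV
  have : NeZero M := ⟨hM.ne'⟩
  let p : Bool → (Fin m → (Fin m → Fin M) × (Fin M → Bool)) → PMF (Fin m × (Fin M × Bool)) :=
    fun σ θ => instancePMF he0 (by linarith) hw0 hw1 hM hm θ σ
  have key := one_third_le_of_isClosenessTester hT hs f (p false) (p false) (p false) (p true)
    (fun θ => ⟨0, by simp, fun x => by simp⟩) (fun θ => by
      have := isFar_instancePMF he0 he1 hw0 hw1 hM hm hMn f θ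
      rwa [show 3 / 2 * e = ε by rw [he]; ring] at this)
  -- Left indices are samples from `p`, right ones from `q`; only the latter see reversed
  -- orientations.
  have hbound := sq_sum_abs_instanceLaw_sub_le (ι := Fin s ⊕ Fin s) he0 he1 hw1 hw
    (fun _ => false) (fun i => i.isRight) hM hm (by simp; omega) (by simp; omega)
  rw [← (Equiv.sumArrowEquivProdArrow (Fin s) (Fin s) _).symm.sum_comp,
    Fintype.sum_prod_type] at hbound
  simp only [instanceLaw, Fintype.prod_sum_type, Equiv.sumArrowEquivProdArrow_symm_apply_inl,
    Equiv.sumArrowEquivProdArrow_symm_apply_inr, Sum.isRight_inl, Sum.isRight_inr] at hbound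
  simp only [p, instancePMF, toReal_ofRealMass] at key
  have h19 := (pow_le_pow_left₀ (by norm_num) key 2).trans hbound
  have hmR : (m : ℝ) = 2 * s := by simp [hmdef]
  have hMR : (0 : ℝ) < M := by exact_mod_cast hM
  have hnMR : (n : ℝ) ≤ 8 * (m * M) := by exact_mod_cast hnM
  have hM2 : (M : ℝ) ^ 2 ≤ 9 * (K * (e ^ 4 * m)) := by
    rw [← mul_div_assoc, le_div_iff₀ (by positivity)] at h19
    linarith
  have he4 : e ^ 4 ≤ ε ^ 4 := pow_le_pow_left₀ he0 (by linarith) 4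
  calc (n : ℝ) ^ 2 ≤ (8 * (m * M)) ^ 2 := pow_le_pow_left₀ (Nat.cast_nonneg _) hnMR 2
    _ = 64 * (m : ℝ) ^ 2 * (M : ℝ) ^ 2 := by ring
    _ ≤ 64 * (m : ℝ) ^ 2 * (9 * (K * (ε ^ 4 * m))) := by
        refine mul_le_mul_of_nonneg_left (hM2.trans ?_) (by positivity)
        gcongr
    _ = 9 * (512 * K) * ((s : ℝ) ^ 3 * ε ^ 4) := by rw [hmR]; ring

end MixtureTesting

theorem mainTheorem6 :
    ∃ c : ℝ, 0 < c ∧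
      ∀ (n : ℕ) [NeZero n], 2 ≤ n →
      ∀ ε : ℝ, 0 < ε → ε ≤ 1 →
      ∀ T : MixtureTesting.Algorithm n,
        MixtureTesting.IsClosenessTester (PMF.uniformOfFintype (Fin n)) ε T →
        ∀ s : ℕ, T.DrawsAtMost s →
          c * max ((n : ℝ) ^ (2 / 3 : ℝ) / ε ^ (4 / 3 : ℝ)) (Real.sqrt n / ε ^ 2) ≤ (s : ℝ) := by
  obtain ⟨C, hC, hclose⟩ := MixtureTesting.closeness_lower_bound
  set L : ℝ := 16 * (1 + C) with hL
  have hL16 : 16 ≤ L := by linarith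
  have hLC : 16 * C ≤ L := by linarith
  have hL0 : 0 < L := by linarith
  refine ⟨L⁻¹, by positivity, ?_⟩
  intro n _ hn ε h0 h1 T hT s hs
  have hs1 := MixtureTesting.one_le_of_isClosenessTester hn h1 hT hs
  have hsR : (1 : ℝ) ≤ s := by exact_mod_cast hs1
  have hn0 : (0 : ℝ) ≤ n := Nat.cast_nonneg n
  set a := (n : ℝ) ^ (2 / 3 : ℝ) / ε ^ (4 / 3 : ℝ)
  set b := Real.sqrt n / ε ^ 2
  have hb0 : 0 ≤ b := by positivity
  have ha3 : a ^ 3 * ε ^ 4 = (n : ℝ) ^ 2 := by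
    have e1 : ((n : ℝ) ^ (2 / 3 : ℝ)) ^ 3 = (n : ℝ) ^ 2 := by
      rw [← Real.rpow_natCast, ← Real.rpow_mul hn0, ← Real.rpow_natCast]
      norm_num
    have e2 : (ε ^ (4 / 3 : ℝ)) ^ 3 = ε ^ 4 := by
      rw [← Real.rpow_natCast, ← Real.rpow_mul h0.le, ← Real.rpow_natCast]
      norm_num
    rw [div_pow, e1, e2, div_mul_cancel₀ _ (by positivity)]
  have hb2 : b ^ 2 * ε ^ 4 = n := by
    rw [div_pow, Real.sq_sqrt hn0, ← pow_mul, div_mul_cancel₀ _ (by positivity)]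
  have hε4 : 0 < ε ^ 4 := by positivity
  have hL2 : L ≤ L ^ 2 := by nlinarith
  have hL3 : L ^ 2 ≤ L ^ 3 := by nlinarith
  have hL4 : L ^ 3 ≤ L ^ 4 := by nlinarith [pow_pos hL0 3]
  have hL256 : 256 ≤ L ^ 2 := by nlinarith
  have hs12 : (s : ℝ) ≤ (s : ℝ) ^ 2 := by nlinarith
  have hs23 : (s : ℝ) ^ 2 ≤ (s : ℝ) ^ 3 := by nlinarith
  have hs34 : (s : ℝ) ^ 3 ≤ (s : ℝ) ^ 4 := by nlinarith [pow_pos (by linarith : (0 : ℝ) < s) 3]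
  have of_le : 8 * s ≤ n → (n : ℝ) ^ 2 ≤ C * ((s : ℝ) ^ 3 * ε ^ 4) := fun h =>
    hclose hs1 h h0 h1 hT hs
  have of_lt : ¬8 * s ≤ n → (n : ℝ) ≤ 8 * s := fun h => by
    exact_mod_cast (not_le.1 h).le
  have hε16 : ¬ε ≤ 1 / 2 → 1 / 16 ≤ ε ^ 4 := fun h => by
    have := pow_le_pow_left₀ (by norm_num) (not_le.1 h).le 4
    norm_num at this ⊢
    exact this
  -- The uniformity bound covers `ε ≤ 1/2`. For larger `ε`, `b² ≤ 16n`, and `n` is controlled by the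
  -- closeness bound if `8s ≤ n` and trivially otherwise.
  have hb : b ≤ L * s := by
    by_cases hε : ε ≤ 1 / 2
    · have hu := MixtureTesting.uniformity_lower_bound hn h0 hε hT hs
      rw [← hb2] at hu
      have : b ^ 2 ≤ (L * s) ^ 2 := by
        have := le_of_mul_le_mul_right hu hε4
        rw [mul_pow]
        nlinarith
      exact le_of_sq_le_sq this (by positivity)
    · have h16 := hε16 hε
      have hbn : b ^ 2 ≤ 16 * n := by nlinarith [sq_nonneg b]
      by_cases h8 : 8 * s ≤ n
      · have hc := of_le h8
        have hn2 : (n : ℝ) ^ 2 ≤ C * (s : ℝ) ^ 4 := by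
          refine hc.trans (mul_le_mul_of_nonneg_left ?_ hC.le)
          refine le_trans (mul_le_of_le_one_right (by positivity) ?_) hs34
          exact pow_le_one₀ h0.le h1
        have h4 : b ^ 4 ≤ (L * s) ^ 4 := by
          have hb4 : b ^ 4 ≤ 256 * (n : ℝ) ^ 2 := by
            have := pow_le_pow_left₀ (sq_nonneg b) hbn 2
            nlinarith
          have hCL : 256 * C ≤ L ^ 4 := by nlinarith
          rw [mul_pow]
          nlinarith [mul_le_mul_of_nonneg_right hCL (by positivity : (0 : ℝ) ≤ (s : ℝ) ^ 4)]
        exact le_of_pow_le_pow_left₀ (by norm_num) (by positivity) h4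
      · have hlt := of_lt h8
        have : b ^ 2 ≤ (L * s) ^ 2 := by
          rw [mul_pow]
          nlinarith
        exact le_of_sq_le_sq this (by positivity)
  -- The closeness bound needs `8s ≤ n`. Otherwise one factor of `n²` is at most `8s` and the
  -- uniformity bound handles the other, or `ε > 1/2` and `n² ≤ 64s²` suffices.
  have ha : a ≤ L * s := by
    have h3 : a ^ 3 ≤ (L * s) ^ 3 := by
      rw [mul_pow]
      by_cases h8 : 8 * s ≤ n
      · have hc := of_le h8
        rw [← ha3, ← mul_assoc] at hc
        have := le_of_mul_le_mul_right hc hε4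
        exact this.trans (mul_le_mul_of_nonneg_right (by linarith) (by positivity))
      · have hlt := of_lt h8
        by_cases hε : ε ≤ 1 / 2
        · have hu := MixtureTesting.uniformity_lower_bound hn h0 hε hT hs
          have : a ^ 3 ≤ 800 * (s : ℝ) ^ 3 := by
            refine le_of_mul_le_mul_right ?_ hε4
            rw [ha3, pow_two]
            calc (n : ℝ) * n ≤ (8 * s) * (100 * (s : ℝ) ^ 2 * ε ^ 4) :=
                  mul_le_mul hlt hu hn0 (by positivity)
              _ = _ := by ring
          exact this.trans (mul_le_mul_of_nonneg_right (by nlinarith) (by positivity))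
        · have h16 := hε16 hε
          have : a ^ 3 ≤ 1024 * (s : ℝ) ^ 3 := by
            refine le_of_mul_le_mul_right ?_ hε4
            rw [ha3]
            have hsq : (n : ℝ) ^ 2 ≤ 64 * (s : ℝ) ^ 2 := by nlinarith
            nlinarith [mul_le_mul_of_nonneg_left h16 (by positivity : (0 : ℝ) ≤ 1024 * (s : ℝ) ^ 3)]
          exact this.trans (mul_le_mul_of_nonneg_right (by nlinarith) (by positivity))
    exact le_of_pow_le_pow_left₀ (by norm_num) (by positivity) h3
  rw [inv_mul_le_iff₀ hL0]
  exact max_le ha hb
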